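/- Let $(\mathcal X,\mu)$ be a measurable space with a $\sigma$-finite reference measure (for instance $\mathbb R$ with Lebesgue measure), let $q$ be a probability density on $\mathcal X$ (pre-change) and, for each $\gamma>0$, let $q_\gamma$ be a probability density on $\mathcal X$ (post-change) that differs from $q$ on a set of positive measure. Assume that for every $\gamma>0$ the log-likelihood ratio $\log\frac{q_\gamma(X)}{q(X)}$ is a.s. finite under $q$ and under $q_\gamma$, and that the Kullback--Leibler divergences $D(q\|q_\gamma)$ and $D(q_\gamma\|q)$ are finite. Let $X_1,X_2,\dots$ be independent observations and $\mathcal F_k=\sigma(X_1,\dots,X_k)$. For $t\in\{1,2,\dots\}$ let $\mathbb E_t$ be the expectation when $X_1,\dots,X_{t-1}$ have density $q$ and $X_t,X_{t+1},\dots$ have density $q_\gamma$, and let $\mathbb E_\infty$ be the expectation when all $X_k$ have density $q$. The optimal worst-case average detection delay is $$n(\gamma)=\inf\Big\{\sup_{t\ge 1}\operatorname{ess\,sup}\,\mathbb E_t\big[(T-t+1)^+\,\big|\,\mathcal F_{t-1}\big]\;:\;T \text{ an extended stopping time of } (\mathcal F_k),\ \mathbb E_\infty[T]\ge\gamma\Big\}.$$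 For $a<0<b$ let $S_k=\sum_{j=1}^k\log\frac{q_\gamma(X_j)}{q(X_j)}$ and $T_{a,b}=\inf\{k\ge1: S_k\notin(a,b)\}$. Assume that the expected overshoots vanish: for all $a<0<b$, with $T=T_{a,b}$, and for i.i.d. observations with density $p\in\{q,q_\gamma\}$, $$\lim_{\gamma\to\infty}\mathbb E_p[S_T-b\mid S_T\ge b]=0,\qquad \lim_{\gamma\to\infty}\mathbb E_p[S_T-a\mid S_T\le a]=0 .$$ Then the largest possible asymptotic order of $n(\gamma)$ is $\gamma$, and it is attained when $\gamma D(q\|q_\gamma)$ converges to a finite constant. Precisely: 1. $n(\gamma)<\infty$ for every $\gamma>0$, and $n(\gamma)=O(\gamma)$ as $\gamma\to\infty$; 2. if $\gamma D(q\|q_\gamma)\to y$ for some $y\in[0,\infty)$, then $n(\gamma)=\Theta(\gamma)$, i.e. the adversary is covert; 3. if $\gamma D(q\|q_\gamma)\to\infty$, then $n(\gamma)=o(\gamma)$. -/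

import Mathlib

open MeasureTheory ProbabilityTheory Filter Asymptotics
open scoped ENNReal Topology

namespace CovertQCD

noncomputable section

/-- `p` is a probability density function with respect to the reference measure `μ`. -/
structure IsPDF {𝓧 : Type*} [MeasurableSpace 𝓧] (μ : Measure 𝓧) (p : 𝓧 → ℝ) : Prop where
  measurable : Measurable p
  nonneg : ∀ x, 0 ≤ p x
  lintegral_eq_one : ∫⁻ x, ENNReal.ofReal (p x) ∂μ = 1

/-- The law on `𝓧` with density `p` with respect to `μ`. -/
def law {𝓧 : Type*} [MeasurableSpace 𝓧] (μ : Measure 𝓧) (p : 𝓧 → ℝ) : Measure 𝓧 :=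
  μ.withDensity fun x => ENNReal.ofReal (p x)

theorem IsPDF.isProbabilityMeasure_law {𝓧 : Type*} [MeasurableSpace 𝓧] {μ : Measure 𝓧}
    {p : 𝓧 → ℝ} (hp : IsPDF μ p) : IsProbabilityMeasure (law μ p) :=
  ⟨by rw [law, withDensity_apply _ MeasurableSet.univ, Measure.restrict_univ,
    hp.lintegral_eq_one]⟩

/-- The Kullback-Leibler divergence `D(p₁‖p₂)` of the densities `p₁`, `p₂`, with value `∞`
when `log (p₁ / p₂)` is not integrable under `p₁`. -/
def D {𝓧 : Type*} [MeasurableSpace 𝓧] (μ : Measure 𝓧) (p₁ p₂ : 𝓧 → ℝ) : ℝ≥0∞ :=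
  InformationTheory.klDiv (law μ p₁) (law μ p₂)

/-! The sample space is the space `ℕ → 𝓧` of observation sequences. The `k`-th observation
`X_k`, `k ≥ 1`, is the coordinate `ω ↦ ω (k - 1)`. -/

/-- `ℱ_k = σ(X_1, …, X_k)`; in particular `ℱ_0` is trivial. -/
def history (𝓧 : Type*) [MeasurableSpace 𝓧] :
    Filtration ℕ (MeasurableSpace.pi : MeasurableSpace (ℕ → 𝓧)) where
  seq k := ⨆ i < k, MeasurableSpace.comap (fun ω : ℕ → 𝓧 => ω i) inferInstance
  mono' _ _ hjk := biSup_mono fun _ hi => lt_of_lt_of_le hi hjk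
  le' _ := iSup₂_le fun i _ => (measurable_pi_apply i).comap_le

/-- Independent observations, all with density `p`. For `p` the pre-change density this is
the no-change model `t = ∞`. -/
def iidMeasure {𝓧 : Type*} [MeasurableSpace 𝓧] (μ : Measure 𝓧) (p : 𝓧 → ℝ) :
    Measure (ℕ → 𝓧) :=
  Measure.infinitePi fun _ => law μ p

/-- Independent observations with change time `t ≥ 1`: `X_1, …, X_{t-1}` have density `q₀`
and `X_t, X_{t+1}, …` have density `q₁`. -/
def changeMeasure {𝓧 : Type*} [MeasurableSpace 𝓧] (μ : Measure 𝓧) (q₀ q₁ : 𝓧 → ℝ) (t : ℕ) :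
    Measure (ℕ → 𝓧) :=
  Measure.infinitePi fun i => if i + 1 < t then law μ q₀ else law μ q₁

/-- Lorden's worst-case average detection delay
`d(T) = sup_{t ≥ 1} ess sup E_t[(T - t + 1)^+ | ℱ_{t-1}]`.
Subtraction in `ℕ∞` is truncated at `0`. -/
def worstDelay {𝓧 : Type*} [MeasurableSpace 𝓧] (μ : Measure 𝓧) (q₀ q₁ : 𝓧 → ℝ)
    (T : (ℕ → 𝓧) → ℕ∞) : ℝ≥0∞ :=
  ⨆ (t : ℕ) (_ : 1 ≤ t),
    essSup
      (condLExp (history 𝓧 (t - 1)) (changeMeasure μ q₀ q₁ t)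
        fun ω => ((T ω + 1 - (t : ℕ∞) : ℕ∞) : ℝ≥0∞))
      (changeMeasure μ q₀ q₁ t)

/-- The optimal worst-case average detection delay: the infimum of `d(T)` over all extended
stopping times `T` with `E_∞[T] ≥ γ`. -/
def optimalDelay {𝓧 : Type*} [MeasurableSpace 𝓧] (μ : Measure 𝓧) (q₀ q₁ : 𝓧 → ℝ)
    (γ : ℝ) : ℝ≥0∞ :=
  ⨅ (T : (ℕ → 𝓧) → ℕ∞) (_ : IsStoppingTime (history 𝓧) T)
    (_ : ENNReal.ofReal γ ≤ ∫⁻ ω, (T ω : ℝ≥0∞) ∂(iidMeasure μ q₀)), worstDelay μ q₀ q₁ T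

/-- The log-likelihood walk `S_k = ∑_{j ≤ k} log (q₁(X_j) / q₀(X_j))`. -/
def logLikelihoodSum {𝓧 : Type*} (q₀ q₁ : 𝓧 → ℝ) (k : ℕ) (ω : ℕ → 𝓧) : ℝ :=
  ∑ i ∈ Finset.range k, Real.log (q₁ (ω i) / q₀ (ω i))

/-- The stopping time `T_{a,b} = inf {k ≥ 1 : S_k ∉ (a, b)}` of the sequential probability
ratio test, equal to `∞` if there is no such `k`. -/
def sprtTime {𝓧 : Type*} (q₀ q₁ : 𝓧 → ℝ) (a b : ℝ) (ω : ℕ → 𝓧) : ℕ∞ :=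
  ⨅ (k : ℕ) (_ : 1 ≤ k ∧ logLikelihoodSum q₀ q₁ k ω ∉ Set.Ioo a b), (k : ℕ∞)

/-- The stopped walk `S_T` at `T = T_{a,b}`. On the event `T = ∞` it takes the value `S_0 = 0`,
which, for `a < 0 < b`, keeps this event out of both `{S_T ≥ b}` and `{S_T ≤ a}`. -/
def sprtValue {𝓧 : Type*} (q₀ q₁ : 𝓧 → ℝ) (a b : ℝ) (ω : ℕ → 𝓧) : ℝ :=
  logLikelihoodSum q₀ q₁ (sprtTime q₀ q₁ a b ω).toNat ω

/-- The expected overshoots of the sequential probability ratio tests between `q` and `q_γ`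
vanish as `γ → ∞` when the observations are i.i.d. with density `p_γ`: for all `a < 0 < b`,
`E[S_T - b | S_T ≥ b] → 0` and `E[S_T - a | S_T ≤ a] → 0`. -/
def OvershootsVanish {𝓧 : Type*} [MeasurableSpace 𝓧] (μ : Measure 𝓧) (q : 𝓧 → ℝ)
    (qγ : ℝ → 𝓧 → ℝ) (p : ℝ → 𝓧 → ℝ) : Prop :=
  ∀ a b : ℝ, a < 0 → 0 < b →
    Tendsto (fun γ : ℝ => ∫ ω, (sprtValue q (qγ γ) a b ω - b)
      ∂(cond (iidMeasure μ (p γ)) {ω | b ≤ sprtValue q (qγ γ) a b ω})) atTop (𝓝 0) ∧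
    Tendsto (fun γ : ℝ => ∫ ω, (sprtValue q (qγ γ) a b ω - a)
      ∂(cond (iidMeasure μ (p γ)) {ω | sprtValue q (qγ γ) a b ω ≤ a})) atTop (𝓝 0)

end

end CovertQCD

/-! The constant time `⌈γ⌉` has delay at most `⌈γ⌉`, which gives finiteness and the order bound
(`optimalDelay_le_natCast`). The rest compares γ with 1/D, where D = D(q‖q_γ): this is the sample
size needed to tell the two laws apart.

If γD stays bounded, choose m of order γ with mD ≤ 1. Over m samples the likelihood ratio is at
least e^{-4} with q-probability at least 1/2. By Markov, a rule with delay at most m e^{-4}/4 that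
is still running at time n rarely survives m further steps after a change. Changing measure back to
q, it stops within those m steps with conditional probability at least 1/4 even without a change
(`iidMeasure_lt_add_le`). Its tail is then geometric and E_∞[T] ≤ 4m < γ, so no admissible rule is
that fast (`le_optimalDelay`).

If γD → ∞, cut time into blocks of length L ≈ δγ. On each block run the test with thresholds -1 and
log(4J), truncated at L, and raise an alarm unless it exits below; J is a constant of order 1/δ.
Change of measure bounds the missed detections by e^{-1} and the upper exits under q by 1/(4J).
Wald's identity, with lower overshoot at most 1, gives P(T_{a,b} > L) ≤ 2/(LD) ≤ 1/(4J)
(`mul_toReal_D_le`). So the first J blocks are free of alarms with probability at least 1/2, while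
after a change each full block raises one with probability at least 1/2. The mean time to false
alarm is at least JL/2 ≥ γ and the delay at most 3L (`optimalDelay_le_of_sprt`); δ is arbitrary. -/

namespace CovertQCD

/-! ### Product measures on sequences: shifts, independence, finite-horizon densities. -/

section Product

variable {𝓧 : Type*} [MeasurableSpace 𝓧]

/-- The shift by `n` on observation sequences. -/
def shift (n : ℕ) (ω : ℕ → 𝓧) : ℕ → 𝓧 := fun i => ω (n + i)

@[fun_prop]
theorem measurable_shift (n : ℕ) : Measurable (shift n : (ℕ → 𝓧) → ℕ → 𝓧) := by
  unfold shift; fun_prop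

theorem measurable_eval_history {i k : ℕ} (h : i < k) :
    Measurable[history 𝓧 k] (fun ω : ℕ → 𝓧 => ω i) := by
  have : MeasurableSpace.comap (fun ω : ℕ → 𝓧 => ω i) inferInstance ≤ history 𝓧 k :=
    le_iSup₂_of_le i h le_rfl
  exact measurable_iff_comap_le.2 this

theorem exists_preimage_of_history {k : ℕ} {E : Set (ℕ → 𝓧)}
    (hE : MeasurableSet[history 𝓧 k] E) :
    ∃ E' : Set (Finset.range k → 𝓧), MeasurableSet E' ∧
      E = (Finset.range k).restrict ⁻¹' E' := by
  have h : (history 𝓧 k : MeasurableSpace (ℕ → 𝓧)) ≤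
      MeasurableSpace.comap (Finset.range k).restrict MeasurableSpace.pi := by
    refine iSup₂_le fun i hi => ?_
    have : (fun ω : ℕ → 𝓧 => ω i) =
        (fun x : Finset.range k → 𝓧 => x ⟨i, Finset.mem_range.2 hi⟩) ∘
          (Finset.range k).restrict := rfl
    rw [this, ← MeasurableSpace.comap_comp]
    exact MeasurableSpace.comap_mono (measurable_iff_comap_le.1 (measurable_pi_apply _))
  obtain ⟨E', h1, h2⟩ := h E hE
  exact ⟨E', h1, h2.symm⟩

theorem measurable_shift_history (n m : ℕ) :
    Measurable[history 𝓧 (n + m), history 𝓧 m] (shift n : (ℕ → 𝓧) → ℕ → 𝓧) := by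
  refine measurable_iff_comap_le.2 ?_
  change MeasurableSpace.comap _ (⨆ i < m, _) ≤ _
  simp only [MeasurableSpace.comap_iSup, MeasurableSpace.comap_comp]
  refine iSup₂_le fun i hi => measurable_iff_comap_le.1 ?_
  exact measurable_eval_history (by omega)

variable {ν ν' : ℕ → Measure 𝓧} [∀ i, IsProbabilityMeasure (ν i)]
  [∀ i, IsProbabilityMeasure (ν' i)]

theorem infinitePi_congr_history {k : ℕ} (h : ∀ i < k, ν i = ν' i) {E : Set (ℕ → 𝓧)}
    (hE : MeasurableSet[history 𝓧 k] E) :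
    Measure.infinitePi ν E = Measure.infinitePi ν' E := by
  obtain ⟨E', hE', rfl⟩ := exists_preimage_of_history hE
  rw [← Measure.map_apply (by fun_prop) hE', ← Measure.map_apply (by fun_prop) hE',
    Measure.infinitePi_map_restrict, Measure.infinitePi_map_restrict]
  congr 2
  ext1 i
  exact h i (Finset.mem_range.1 i.2)

theorem infinitePi_map_shift (n : ℕ) :
    (Measure.infinitePi ν).map (shift n) = Measure.infinitePi fun i => ν (n + i) :=
  Measure.map_infinitePi_infinitePi_of_inj (P := ν) (f := fun i => n + i)
    (add_right_injective n)

theorem indep_history_shift (n : ℕ) :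
    Indep (history 𝓧 n) (MeasurableSpace.comap (shift n) MeasurableSpace.pi)
      (Measure.infinitePi ν) := by
  have h1 : iIndep (fun i => MeasurableSpace.comap (fun ω : ℕ → 𝓧 => ω i) inferInstance)
      (Measure.infinitePi ν) :=
    iIndepFun_infinitePi (P := ν) (X := fun _ x => x) (fun _ => measurable_id)
  have h2 := indep_iSup_of_disjoint (fun i => (measurable_pi_apply i).comap_le) h1
    (S := {i | i < n}) (T := {i | n ≤ i})
    (Set.disjoint_left.2 fun i (hi : i < n) (hi' : n ≤ i) => by omega)
  refine indep_of_indep_of_le_right h2 ?_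
  rw [MeasurableSpace.pi]
  simp only [MeasurableSpace.comap_iSup, MeasurableSpace.comap_comp]
  refine iSup_le fun i => ?_
  exact le_iSup₂_of_le (f := fun i (_ : i ∈ {i | n ≤ i}) =>
    MeasurableSpace.comap (fun ω : ℕ → 𝓧 => ω i) inferInstance) (n + i)
    (Nat.le_add_right n i) le_rfl

theorem infinitePi_inter_shift {n : ℕ} {A B : Set (ℕ → 𝓧)}
    (hA : MeasurableSet[history 𝓧 n] A) (hB : MeasurableSet B) :
    Measure.infinitePi ν (A ∩ shift n ⁻¹' B) =
      Measure.infinitePi ν A * Measure.infinitePi (fun i => ν (n + i)) B := by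
  rw [(Indep_iff _ _ _).1 (indep_history_shift n) A _ hA ⟨B, hB, rfl⟩, ← infinitePi_map_shift n,
    Measure.map_apply (measurable_shift n) hB]

/-- On infinite sequences the two products may be mutually singular, so a density exists only up to
a finite horizon. The factors of `ν'` beyond k are replaced by those of `ν`, which is invisible to
sets in the history at k; the resulting product has the stated density, as is checked on boxes. -/
theorem infinitePi_withDensity {f : ℕ → 𝓧 → ℝ≥0∞} (hf : ∀ i, Measurable (f i)) {k : ℕ}
    (hν : ∀ i < k, ν' i = (ν i).withDensity (f i)) {E : Set (ℕ → 𝓧)}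
    (hE : MeasurableSet[history 𝓧 k] E) :
    Measure.infinitePi ν' E =
      ∫⁻ ω in E, ∏ i ∈ Finset.range k, f i (ω i) ∂Measure.infinitePi ν := by
  classical
  let ν'' : ℕ → Measure 𝓧 := fun i => if i < k then ν' i else ν i
  have : ∀ i, IsProbabilityMeasure (ν'' i) := fun i => by
    simp only [ν'']; split_ifs <;> infer_instance
  have hm : MeasurableSet E := (history 𝓧).le k E hE
  rw [infinitePi_congr_history (ν := ν') (ν' := ν'') (fun i hi => by simp [ν'', hi]) hE,
    ← withDensity_apply _ hm]
  congr 1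
  symm
  refine Measure.eq_infinitePi ν'' fun s t ht => ?_
  let g : ℕ → 𝓧 → ℝ≥0∞ := fun i x =>
    (if i < k then f i x else 1) * (if i ∈ s then (t i).indicator 1 x else 1)
  have hg : ∀ i, Measurable (g i) := fun i => by
    refine Measurable.mul ?_ ?_
    · split_ifs
      exacts [hf i, measurable_const]
    · split_ifs
      exacts [measurable_one.indicator (ht i), measurable_const]
  have hms : MeasurableSet ((s : Set ℕ).pi t) := .pi s.countable_toSet fun i _ => ht i
  have hprod : ∀ ω : ℕ → 𝓧, ((s : Set ℕ).pi t).indicator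
      (fun ω => ∏ i ∈ Finset.range k, f i (ω i)) ω = ∏ i ∈ Finset.range k ∪ s, g i (ω i) := by
    intro ω
    simp only [g]
    rw [Finset.prod_mul_distrib]
    have e1 : ∏ i ∈ Finset.range k ∪ s, (if i < k then f i (ω i) else 1) =
        ∏ i ∈ Finset.range k, f i (ω i) := by
      rw [← Finset.prod_subset Finset.subset_union_left (fun i _ hi => by
        rw [if_neg (by simpa using hi)])]
      exact Finset.prod_congr rfl fun i hi => by rw [if_pos (by simpa using hi)]
    have e2 : ∏ i ∈ Finset.range k ∪ s, (if i ∈ s then (t i).indicator (1 : 𝓧 → ℝ≥0∞) (ω i)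
        else 1) = ∏ i ∈ s, (t i).indicator (1 : 𝓧 → ℝ≥0∞) (ω i) := by
      rw [← Finset.prod_subset Finset.subset_union_right (fun i _ hi => by rw [if_neg hi])]
      exact Finset.prod_congr rfl fun i hi => by rw [if_pos hi]
    rw [e1, e2]
    by_cases h : ω ∈ (s : Set ℕ).pi t
    · rw [Set.indicator_of_mem h, Finset.prod_congr rfl (g := fun _ => (1 : ℝ≥0∞))
        (fun i hi => Set.indicator_of_mem (h i hi) _)]
      simp
    · rw [Set.indicator_of_notMem h]
      simp only [Set.mem_pi, not_forall] at h
      obtain ⟨i, hi, hi'⟩ := h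
      rw [Finset.prod_eq_zero (i := i) hi (Set.indicator_of_notMem hi' _), mul_zero]
  rw [withDensity_apply _ hms, ← lintegral_indicator hms]
  simp_rw [hprod]
  rw [lintegral_prod_eq_prod_lintegral_of_indepFun _ _
    (iIndepFun_infinitePi (P := ν) (X := g) hg) (fun i => (hg i).comp (measurable_pi_apply i))]
  have hi : ∀ i, ∫⁻ ω, g i (ω i) ∂Measure.infinitePi ν = if i ∈ s then ν'' i (t i) else 1 := by
    intro i
    have e : ∫⁻ ω, g i (ω i) ∂Measure.infinitePi ν = ∫⁻ x, g i x ∂ν i := by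
      rw [← Measure.infinitePi_map_eval ν i, lintegral_map (hg i) (measurable_pi_apply i)]
    rw [e]
    have e2 : ∫⁻ x, g i x ∂ν i =
        ∫⁻ x, (if i ∈ s then (t i).indicator (1 : 𝓧 → ℝ≥0∞) x else 1) ∂ν'' i := by
      simp only [g, ν'']
      split_ifs with h1
      · rw [hν i h1, lintegral_withDensity_eq_lintegral_mul _ (hf i)
          (measurable_one.indicator (ht i))]
        rfl
      · rw [hν i h1, lintegral_withDensity_eq_lintegral_mul _ (hf i) measurable_const]
        rfl
      · simp
      · simp
    rw [e2]
    split_ifs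
    · rw [lintegral_indicator_one (ht i)]
    · simp
  simp_rw [hi]
  rw [← Finset.prod_subset Finset.subset_union_right (fun i _ hi => by rw [if_neg hi])]
  exact Finset.prod_congr rfl fun i hi => by rw [if_pos hi]

end Product

/-! ### The worst-case delay and the trivial upper bound. -/

section Delay

theorem toENNReal_eq_tsum (T : ℕ∞) :
    (T : ℝ≥0∞) = ∑' k : ℕ, if (k : ℕ∞) < T then 1 else 0 := by
  induction T using ENat.recTopCoe with
  | top => simp
  | coe n =>
    rw [tsum_eq_sum (s := Finset.range n) (fun k hk => if_neg (by simpa using hk)),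
      Finset.sum_congr rfl (g := fun _ => (1 : ℝ≥0∞))
        (fun k hk => if_pos (by simpa using hk))]
    simp

variable {𝓧 : Type*} [MeasurableSpace 𝓧] {μ : Measure 𝓧} {p₀ p₁ : 𝓧 → ℝ}

theorem isProbabilityMeasure_ite (h₀ : IsPDF μ p₀) (h₁ : IsPDF μ p₁) (t i : ℕ) :
    IsProbabilityMeasure (if i + 1 < t then law μ p₀ else law μ p₁) := by
  split_ifs
  exacts [h₀.isProbabilityMeasure_law, h₁.isProbabilityMeasure_law]

theorem isProbabilityMeasure_iidMeasure (h₀ : IsPDF μ p₀) :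
    IsProbabilityMeasure (iidMeasure μ p₀) := by
  have := h₀.isProbabilityMeasure_law
  unfold iidMeasure; infer_instance

theorem isProbabilityMeasure_changeMeasure (h₀ : IsPDF μ p₀) (h₁ : IsPDF μ p₁) (t : ℕ) :
    IsProbabilityMeasure (changeMeasure μ p₀ p₁ t) := by
  have := isProbabilityMeasure_ite h₀ h₁ t
  unfold changeMeasure; infer_instance

/-- A bound on an essential supremum of a conditional expectation is tested by integrating over the
events of the conditioning σ-algebra. Both delay estimates use this form; here n = t - 1 is the
number of pre-change observations. -/
theorem worstDelay_le_iff (h₀ : IsPDF μ p₀) (h₁ : IsPDF μ p₁) {T : (ℕ → 𝓧) → ℕ∞} {c : ℝ≥0∞} :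
    worstDelay μ p₀ p₁ T ≤ c ↔ ∀ n : ℕ, ∀ A, MeasurableSet[history 𝓧 n] A →
      ∫⁻ ω in A, ((T ω - n : ℕ∞) : ℝ≥0∞) ∂changeMeasure μ p₀ p₁ (n + 1) ≤
        c * changeMeasure μ p₀ p₁ (n + 1) A := by
  have key : ∀ n : ℕ, (essSup (condLExp (history 𝓧 n) (changeMeasure μ p₀ p₁ (n + 1))
        fun ω => ((T ω + 1 - ((n + 1 : ℕ) : ℕ∞) : ℕ∞) : ℝ≥0∞))
          (changeMeasure μ p₀ p₁ (n + 1)) ≤ c ↔ ∀ A, MeasurableSet[history 𝓧 n] A →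
      ∫⁻ ω in A, ((T ω - n : ℕ∞) : ℝ≥0∞) ∂changeMeasure μ p₀ p₁ (n + 1) ≤
        c * changeMeasure μ p₀ p₁ (n + 1) A) := by
    intro n
    have := isProbabilityMeasure_changeMeasure h₀ h₁ (n + 1)
    have hT : ∀ ω, T ω + 1 - ((n + 1 : ℕ) : ℕ∞) = T ω - n := fun ω => by
      induction T ω using ENat.recTopCoe with
      | top => simp
      | coe k => norm_cast; omega
    simp_rw [hT]
    set P := changeMeasure μ p₀ p₁ (n + 1)
    have hle := (history 𝓧).le n
    constructor
    · intro h A hA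
      rw [← setLIntegral_condLExp hle P _ hA, ← setLIntegral_const]
      exact lintegral_mono_ae (ae_restrict_of_ae
        ((ENNReal.ae_le_essSup _).mono fun ω hω => hω.trans h))
    · intro h
      refine essSup_le_of_ae_le _ (ae_le_of_ae_le_trim (hm := hle) ?_)
      refine ae_le_of_forall_setLIntegral_le_of_sigmaFinite (μ := P.trim hle)
        (measurable_condLExp _ _ _) fun A hA _ => ?_
      rw [setLIntegral_condLExp_trim hle P _ hA, setLIntegral_const, trim_measurableSet_eq hle hA]
      exact h A hA
  constructor
  · intro h n
    refine (key n).1 (le_trans ?_ h)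
    exact le_iSup₂_of_le (n + 1) (Nat.le_add_left 1 n) le_rfl
  · intro h
    refine iSup₂_le fun t ht => ?_
    obtain ⟨n, rfl⟩ : ∃ n, t = n + 1 := ⟨t - 1, by omega⟩
    exact (key n).2 (h n)

theorem optimalDelay_le_natCast (h₀ : IsPDF μ p₀) (h₁ : IsPDF μ p₁) {γ : ℝ} {N : ℕ}
    (hN : γ ≤ N) : optimalDelay μ p₀ p₁ γ ≤ N := by
  have := isProbabilityMeasure_iidMeasure h₀
  refine iInf_le_of_le (fun _ => (N : ℕ∞)) (iInf₂_le_of_le (isStoppingTime_const _ N) ?_ ?_)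
  · simpa using ENNReal.ofReal_le_ofReal hN
  · refine (worstDelay_le_iff h₀ h₁).2 fun n A hA => ?_
    rw [setLIntegral_const]
    gcongr
    rw [← ENat.toENNReal_coe, ENat.toENNReal_le]
    exact tsub_le_self

end Delay

/-- Splitting off the first m terms gives S ≤ m + (3/4) S. This is solved for partial sums, which
are finite, so that the subtraction is legitimate. -/
theorem tsum_le_of_add_le {u : ℕ → ℝ≥0∞} {m : ℕ} (h1 : ∀ k, u k ≤ 1)
    (hu : ∀ n, u (n + m) ≤ 3 / 4 * u n) : ∑' k, u k ≤ 4 * m := by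
  refine ENNReal.tsum_le_of_sum_range_le fun N => ?_
  have hS : ∑ k ∈ Finset.range N, u k ≤ m + 3 / 4 * ∑ k ∈ Finset.range N, u k := by
    calc ∑ k ∈ Finset.range N, u k ≤ ∑ k ∈ Finset.range (m + N), u k :=
          Finset.sum_le_sum_of_subset (Finset.range_subset_range.2 (by omega))
      _ = ∑ k ∈ Finset.range m, u k + ∑ k ∈ Finset.range N, u (m + k) :=
          Finset.sum_range_add _ _ _
      _ ≤ ∑ k ∈ Finset.range m, 1 + ∑ k ∈ Finset.range N, 3 / 4 * u k := by
          gcongr with k _ k _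
          · exact h1 k
          · rw [add_comm]; exact hu k
      _ = m + 3 / 4 * ∑ k ∈ Finset.range N, u k := by simp [Finset.mul_sum]
  have hfin : ∑ k ∈ Finset.range N, u k ≠ ∞ :=
    ENNReal.sum_ne_top.2 fun k _ => ne_top_of_le_ne_top ENNReal.one_ne_top (h1 k)
  lift ∑ k ∈ Finset.range N, u k to NNReal using hfin with s
  have h2 : (s : ℝ≥0∞) ≤ ((m + 3 / 4 * s : NNReal) : ℝ≥0∞) := by
    refine hS.trans_eq ?_
    push_cast
    rfl
  rw [ENNReal.coe_le_coe, ← NNReal.coe_le_coe] at h2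
  push_cast at h2
  have h3 : s ≤ 4 * (m : NNReal) := by
    rw [← NNReal.coe_le_coe]; push_cast; linarith
  exact_mod_cast h3

/-! ### Likelihood ratios, change of measure, and divergence as drift. -/

section Likelihood

theorem exp_logLikelihoodSum {𝓧 : Type*} {p₀ p₁ : 𝓧 → ℝ} {m : ℕ} {ω : ℕ → 𝓧}
    (h : ∀ i, 0 < p₀ (ω i) ∧ 0 < p₁ (ω i)) :
    Real.exp (logLikelihoodSum p₀ p₁ m ω) = ∏ i ∈ Finset.range m, (p₁ (ω i) / p₀ (ω i)) := by
  rw [logLikelihoodSum, Real.exp_sum]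
  exact Finset.prod_congr rfl fun i _ => Real.exp_log (div_pos (h i).2 (h i).1)

variable {𝓧 : Type*} [MeasurableSpace 𝓧] {μ : Measure 𝓧} {p₀ p₁ : 𝓧 → ℝ}

theorem law_eq_withDensity (h₀ : IsPDF μ p₀) (h₁ : IsPDF μ p₁)
    (hpos : ∀ᵐ x ∂law μ p₁, 0 < p₀ x ∧ 0 < p₁ x) :
    law μ p₁ = (law μ p₀).withDensity fun x => ENNReal.ofReal (p₁ x / p₀ x) := by
  have m₀ := h₀.measurable
  have m₁ := h₁.measurable
  rw [law, law, ← withDensity_mul _ (by fun_prop) (by fun_prop)]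
  refine withDensity_congr_ae ?_
  rw [law, ae_withDensity_iff (by fun_prop)] at hpos
  filter_upwards [hpos] with x hx
  simp only [Pi.mul_apply]
  rw [← ENNReal.ofReal_mul (h₀.nonneg x)]
  by_cases h : ENNReal.ofReal (p₁ x) = 0
  · have : p₁ x = 0 := le_antisymm (ENNReal.ofReal_eq_zero.1 h) (h₁.nonneg x)
    simp [this]
  · rw [mul_div_cancel₀ _ (hx h).1.ne']

theorem measurable_logLikelihoodSum_history (h₀ : IsPDF μ p₀) (h₁ : IsPDF μ p₁) {j k : ℕ}
    (hjk : j ≤ k) : Measurable[history 𝓧 k] (logLikelihoodSum p₀ p₁ j) := by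
  have m₀ := h₀.measurable
  have m₁ := h₁.measurable
  refine Finset.measurable_fun_sum _ fun i hi => ?_
  exact (by fun_prop : Measurable fun x => Real.log (p₁ x / p₀ x)).comp
    (measurable_eval_history ((Finset.mem_range.1 hi).trans_le hjk))

theorem measurable_logLikelihoodSum (h₀ : IsPDF μ p₀) (h₁ : IsPDF μ p₁) (k : ℕ) :
    Measurable (logLikelihoodSum p₀ p₁ k) :=
  (measurable_logLikelihoodSum_history h₀ h₁ le_rfl).mono ((history 𝓧).le k) le_rfl

theorem ae_iidMeasure_forall (h₀ : IsPDF μ p₀) {s : 𝓧 → Prop} (h : ∀ᵐ x ∂law μ p₀, s x) :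
    ∀ᵐ ω ∂iidMeasure μ p₀, ∀ i, s (ω i) := by
  have := h₀.isProbabilityMeasure_law
  exact ae_all_iff.2 fun i =>
    (measurePreserving_eval_infinitePi (fun _ => law μ p₀) i).quasiMeasurePreserving.ae h

theorem iidMeasure_map_shift (h₀ : IsPDF μ p₀) (n : ℕ) :
    (iidMeasure μ p₀).map (shift n) = iidMeasure μ p₀ := by
  have := h₀.isProbabilityMeasure_law
  exact infinitePi_map_shift n

theorem iidMeasure_inter_shift (h₀ : IsPDF μ p₀) {n : ℕ} {A B : Set (ℕ → 𝓧)}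
    (hA : MeasurableSet[history 𝓧 n] A) (hB : MeasurableSet B) :
    iidMeasure μ p₀ (A ∩ shift n ⁻¹' B) = iidMeasure μ p₀ A * iidMeasure μ p₀ B := by
  have := h₀.isProbabilityMeasure_law
  exact infinitePi_inter_shift hA hB

theorem changeMeasure_inter_shift (h₀ : IsPDF μ p₀) (h₁ : IsPDF μ p₁) {n k : ℕ} (hk : n ≤ k)
    {A B : Set (ℕ → 𝓧)} (hA : MeasurableSet[history 𝓧 k] A) (hB : MeasurableSet B) :
    changeMeasure μ p₀ p₁ (n + 1) (A ∩ shift k ⁻¹' B) =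
      changeMeasure μ p₀ p₁ (n + 1) A * iidMeasure μ p₁ B := by
  have := isProbabilityMeasure_ite h₀ h₁ (n + 1)
  refine (infinitePi_inter_shift hA hB).trans ?_
  congr 2
  unfold iidMeasure
  congr 1
  ext1 i
  rw [if_neg (by omega)]

theorem changeMeasure_apply_history (h₀ : IsPDF μ p₀) (h₁ : IsPDF μ p₁) {n : ℕ}
    {A : Set (ℕ → 𝓧)} (hA : MeasurableSet[history 𝓧 n] A) :
    changeMeasure μ p₀ p₁ (n + 1) A = iidMeasure μ p₀ A := by
  have := isProbabilityMeasure_ite h₀ h₁ (n + 1)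
  have := h₀.isProbabilityMeasure_law
  exact infinitePi_congr_history (fun i hi => if_pos (by omega)) hA

theorem changeMeasure_one : changeMeasure μ p₀ p₁ 1 = iidMeasure μ p₁ := by
  simp [changeMeasure, iidMeasure]

/-- The first n factors of the two products agree, so only the m observations after the change enter
the likelihood ratio. -/
theorem changeMeasure_apply (h₀ : IsPDF μ p₀) (h₁ : IsPDF μ p₁)
    (hpos₀ : ∀ᵐ x ∂law μ p₀, 0 < p₀ x ∧ 0 < p₁ x)
    (hpos₁ : ∀ᵐ x ∂law μ p₁, 0 < p₀ x ∧ 0 < p₁ x) {n m : ℕ} {E : Set (ℕ → 𝓧)}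
    (hE : MeasurableSet[history 𝓧 (n + m)] E) :
    changeMeasure μ p₀ p₁ (n + 1) E =
      ∫⁻ ω in E, ENNReal.ofReal (Real.exp (logLikelihoodSum p₀ p₁ m (shift n ω)))
        ∂iidMeasure μ p₀ := by
  have m₀ := h₀.measurable
  have m₁ := h₁.measurable
  have := isProbabilityMeasure_ite h₀ h₁ (n + 1)
  have := h₀.isProbabilityMeasure_law
  refine (infinitePi_withDensity (ν := fun _ => law μ p₀)
    (f := fun i x => if i < n then 1 else ENNReal.ofReal (p₁ x / p₀ x)) (fun i => ?_)
    (fun i _ => ?_) hE).trans ?_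
  · split_ifs <;> fun_prop
  · by_cases hi : i < n
    · simp only [hi, if_true, Nat.add_lt_add_iff_right]
      exact (withDensity_one).symm
    · simp only [hi, if_false, Nat.add_lt_add_iff_right]
      exact law_eq_withDensity h₀ h₁ hpos₁
  · refine lintegral_congr_ae (ae_restrict_of_ae ?_)
    filter_upwards [ae_iidMeasure_forall h₀ hpos₀] with ω hω
    rw [exp_logLikelihoodSum (ω := shift n ω) (fun i => hω (n + i)), Finset.prod_range_add,
      Finset.prod_eq_one (fun i hi => if_pos (Finset.mem_range.1 hi)), one_mul,
      ENNReal.ofReal_prod_of_nonneg (fun i _ => div_nonneg (h₁.nonneg _) (h₀.nonneg _))]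
    exact Finset.prod_congr rfl fun i _ => if_neg (by omega)

theorem iidMeasure_apply (h₀ : IsPDF μ p₀) (h₁ : IsPDF μ p₁)
    (hpos₀ : ∀ᵐ x ∂law μ p₀, 0 < p₀ x ∧ 0 < p₁ x)
    (hpos₁ : ∀ᵐ x ∂law μ p₁, 0 < p₀ x ∧ 0 < p₁ x) {m : ℕ} {E : Set (ℕ → 𝓧)}
    (hE : MeasurableSet[history 𝓧 m] E) :
    iidMeasure μ p₁ E =
      ∫⁻ ω in E, ENNReal.ofReal (Real.exp (logLikelihoodSum p₀ p₁ m ω)) ∂iidMeasure μ p₀ := by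
  have h := changeMeasure_apply h₀ h₁ hpos₀ hpos₁ (n := 0) (m := m) (by rwa [zero_add])
  have h0 : ∀ ω : ℕ → 𝓧, shift 0 ω = ω := fun ω => funext fun i => by simp [shift]
  simpa only [zero_add, changeMeasure_one, h0] using h

theorem integrable_log_and_toReal_D (h₀ : IsPDF μ p₀) (h₁ : IsPDF μ p₁)
    (hpos₀ : ∀ᵐ x ∂law μ p₀, 0 < p₀ x ∧ 0 < p₁ x) (hD : D μ p₀ p₁ ≠ ∞) :
    Integrable (fun x => Real.log (p₁ x / p₀ x)) (law μ p₀) ∧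
      ∫ x, Real.log (p₁ x / p₀ x) ∂law μ p₀ = -(D μ p₀ p₁).toReal := by
  have m₀ := h₀.measurable
  have m₁ := h₁.measurable
  have := h₀.isProbabilityMeasure_law
  have := h₁.isProbabilityMeasure_law
  obtain ⟨hac, hint⟩ := InformationTheory.klDiv_ne_top_iff.1 hD
  have hllr : (fun x => Real.log (p₁ x / p₀ x)) =ᵐ[law μ p₀]
      fun x => -llr (law μ p₀) (law μ p₁) x := by
    have e := law_eq_withDensity h₁ h₀ (hpos₀.mono fun x hx => hx.symm)
    have h := Measure.rnDeriv_withDensity (law μ p₁)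
      (f := fun x => ENNReal.ofReal (p₀ x / p₁ x)) (by fun_prop)
    rw [← e] at h
    filter_upwards [hac.ae_le h] with x hx
    rw [llr, hx, ENNReal.toReal_ofReal (div_nonneg (h₀.nonneg x) (h₁.nonneg x)), ← Real.log_inv,
      inv_div]
  refine ⟨(hint.neg.congr hllr.symm), ?_⟩
  rw [integral_congr_ae hllr, integral_neg, D,
    InformationTheory.toReal_klDiv_of_measure_eq hac (by simp)]

theorem integrable_eval (h₀ : IsPDF μ p₀) {f : 𝓧 → ℝ} (hf : Integrable f (law μ p₀)) (i : ℕ) :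
    Integrable (fun ω : ℕ → 𝓧 => f (ω i)) (iidMeasure μ p₀) := by
  have := h₀.isProbabilityMeasure_law
  exact (measurePreserving_eval_infinitePi (fun _ => law μ p₀) i).integrable_comp_of_integrable hf

theorem integral_eval (h₀ : IsPDF μ p₀) {f : 𝓧 → ℝ} (hf : Integrable f (law μ p₀)) (i : ℕ) :
    ∫ ω, f (ω i) ∂iidMeasure μ p₀ = ∫ x, f x ∂law μ p₀ := by
  have := h₀.isProbabilityMeasure_law
  have h := Measure.infinitePi_map_eval (fun _ => law μ p₀) i
  conv_rhs => rw [← h]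
  rw [integral_map (measurable_pi_apply i).aemeasurable (by rw [h]; exact hf.1)]
  rfl

/-- Markov's inequality at level 4 for e^S - S, which is nonnegative and has mean 1 + mD ≤ 2. Adding
e^S makes the variable nonnegative at the cost of just 1 in the mean, so no second moment of S is
needed. -/
theorem iidMeasure_logLikelihoodSum_lt_le (h₀ : IsPDF μ p₀) (h₁ : IsPDF μ p₁)
    (hpos₀ : ∀ᵐ x ∂law μ p₀, 0 < p₀ x ∧ 0 < p₁ x)
    (hpos₁ : ∀ᵐ x ∂law μ p₁, 0 < p₀ x ∧ 0 < p₁ x) (hD : D μ p₀ p₁ ≠ ∞) {m : ℕ}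
    (hm : m * (D μ p₀ p₁).toReal ≤ 1) :
    iidMeasure μ p₀ {ω | logLikelihoodSum p₀ p₁ m ω < -4} ≤ 1 / 2 := by
  have := isProbabilityMeasure_iidMeasure h₀
  have := isProbabilityMeasure_iidMeasure h₁
  obtain ⟨hint, hval⟩ := integrable_log_and_toReal_D h₀ h₁ hpos₀ hD
  have hSm := measurable_logLikelihoodSum h₀ h₁ m
  have hS : Integrable (logLikelihoodSum p₀ p₁ m) (iidMeasure μ p₀) :=
    integrable_finsetSum _ fun i _ => integrable_eval h₀ hint i
  have hSv : ∫ ω, logLikelihoodSum p₀ p₁ m ω ∂iidMeasure μ p₀ = -(m * (D μ p₀ p₁).toReal) := by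
    unfold logLikelihoodSum
    rw [integral_finsetSum _ fun i _ => integrable_eval h₀ hint i,
      Finset.sum_congr rfl fun i _ => integral_eval h₀ hint i, hval]
    simp
  have hl : ∫⁻ ω, ENNReal.ofReal (Real.exp (logLikelihoodSum p₀ p₁ m ω)) ∂iidMeasure μ p₀ = 1 := by
    have h := iidMeasure_apply h₀ h₁ hpos₀ hpos₁ (m := m) (@MeasurableSet.univ _ (history 𝓧 m))
    simpa using h.symm
  have hexp : Integrable (fun ω => Real.exp (logLikelihoodSum p₀ p₁ m ω)) (iidMeasure μ p₀) := by
    refine ⟨by fun_prop, ?_⟩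
    rw [hasFiniteIntegral_iff_ofReal (ae_of_all _ fun ω => (Real.exp_pos _).le), hl]
    exact ENNReal.one_lt_top
  have hexpv : ∫ ω, Real.exp (logLikelihoodSum p₀ p₁ m ω) ∂iidMeasure μ p₀ = 1 := by
    rw [integral_eq_lintegral_of_nonneg_ae (ae_of_all _ fun ω => (Real.exp_pos _).le)
      hexp.1, hl]
    simp
  have hM := mul_meas_ge_le_integral_of_nonneg (μ := iidMeasure μ p₀)
    (f := fun ω => Real.exp (logLikelihoodSum p₀ p₁ m ω) - logLikelihoodSum p₀ p₁ m ω)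
    (ae_of_all _ fun ω => by
      have := Real.add_one_le_exp (logLikelihoodSum p₀ p₁ m ω)
      simp only [Pi.zero_apply]; linarith) (hexp.sub hS) 4
  rw [integral_sub hexp hS, hexpv, hSv] at hM
  have hsub : {ω | logLikelihoodSum p₀ p₁ m ω < -4} ⊆
      {ω | 4 ≤ Real.exp (logLikelihoodSum p₀ p₁ m ω) - logLikelihoodSum p₀ p₁ m ω} := by
    intro ω (hω : logLikelihoodSum p₀ p₁ m ω < -4)
    have := Real.exp_pos (logLikelihoodSum p₀ p₁ m ω)
    simp only [Set.mem_ofPred_eq]; linarith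
  have h2 : (iidMeasure μ p₀).real {ω | logLikelihoodSum p₀ p₁ m ω < -4} ≤ 1 / 2 := by
    have := measureReal_mono (μ := iidMeasure μ p₀) hsub
    linarith
  rw [← ENNReal.ofReal_toReal (measure_ne_top (iidMeasure μ p₀) _)]
  refine (ENNReal.ofReal_le_ofReal h2).trans_eq ?_
  rw [ENNReal.ofReal_div_of_pos (by norm_num)]
  simp

end Likelihood

/-! ### Lower bound: a fast rule has a geometric tail without any change. -/

section LowerBound

variable {𝓧 : Type*} [MeasurableSpace 𝓧] {μ : Measure 𝓧} {p₀ p₁ : 𝓧 → ℝ}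

theorem measurableSet_lt_of_isStoppingTime {T : (ℕ → 𝓧) → ℕ∞}
    (hT : IsStoppingTime (history 𝓧) T) (n : ℕ) :
    MeasurableSet[history 𝓧 n] {ω | (n : ℕ∞) < T ω} := by
  have h := (hT n).compl
  convert h using 1
  ext ω
  exact (not_le (a := T ω) (b := (n : ℕ∞))).symm

theorem iidMeasure_lt_add_le (h₀ : IsPDF μ p₀) (h₁ : IsPDF μ p₁)
    (hpos₀ : ∀ᵐ x ∂law μ p₀, 0 < p₀ x ∧ 0 < p₁ x)
    (hpos₁ : ∀ᵐ x ∂law μ p₁, 0 < p₀ x ∧ 0 < p₁ x) (hD : D μ p₀ p₁ ≠ ∞) {m : ℕ} (hm0 : 0 < m)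
    (hm : m * (D μ p₀ p₁).toReal ≤ 1) {T : (ℕ → 𝓧) → ℕ∞} (hT : IsStoppingTime (history 𝓧) T)
    (hd : worstDelay μ p₀ p₁ T ≤ m * ENNReal.ofReal (Real.exp (-4)) / 4) (n : ℕ) :
    iidMeasure μ p₀ {ω | ((n + m : ℕ) : ℕ∞) < T ω} ≤
      3 / 4 * iidMeasure μ p₀ {ω | (n : ℕ∞) < T ω} := by
  set P := iidMeasure μ p₀
  set A := {ω | (n : ℕ∞) < T ω}
  set E := {ω | ((n + m : ℕ) : ℕ∞) < T ω}
  have hA : MeasurableSet[history 𝓧 n] A := measurableSet_lt_of_isStoppingTime hT n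
  have hE : MeasurableSet[history 𝓧 (n + m)] E := measurableSet_lt_of_isStoppingTime hT (n + m)
  have hEm : MeasurableSet E := (history 𝓧).le _ _ hE
  have hEA : E ⊆ A := fun ω (hω : ((n + m : ℕ) : ℕ∞) < T ω) =>
    show (n : ℕ∞) < T ω from lt_of_le_of_lt (by exact_mod_cast Nat.le_add_right n m) hω
  have hSm := measurable_logLikelihoodSum h₀ h₁ m
  set e := ENNReal.ofReal (Real.exp (-4))
  have he0 : e ≠ 0 := by simp [e, Real.exp_pos]
  have het : e ≠ ∞ := ENNReal.ofReal_ne_top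
  have hm0' : (m : ℝ≥0∞) ≠ 0 := by exact_mod_cast hm0.ne'
  have hmt : (m : ℝ≥0∞) ≠ ∞ := ENNReal.natCast_ne_top m
  -- Markov under the change at n + 1: the delay is at least m on `E`, and `A` has the same
  -- probability as under no change because it is decided by the first n observations.
  have hPt : changeMeasure μ p₀ p₁ (n + 1) E ≤ e / 4 * P A := by
    have h := (worstDelay_le_iff h₀ h₁).1 hd n A hA
    rw [changeMeasure_apply_history h₀ h₁ hA] at h
    have h2 : m * changeMeasure μ p₀ p₁ (n + 1) E ≤
        ∫⁻ ω in A, ((T ω - n : ℕ∞) : ℝ≥0∞) ∂changeMeasure μ p₀ p₁ (n + 1) := by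
      rw [← setLIntegral_const]
      refine (setLIntegral_mono_ae' hEm
        (ae_of_all _ fun ω (hω : ((n + m : ℕ) : ℕ∞) < T ω) => ?_)).trans
        (lintegral_mono_set hEA)
      rw [← ENat.toENNReal_coe, ENat.toENNReal_le]
      refine ENat.le_sub_of_add_le_left (ENat.natCast_ne_top n) ?_
      exact_mod_cast hω.le
    have h3 : m * changeMeasure μ p₀ p₁ (n + 1) E ≤ m * (e / 4 * P A) := by
      refine (h2.trans h).trans_eq ?_
      rw [mul_div_assoc, mul_assoc]
    exact (ENNReal.mul_le_mul_iff_right hm0' hmt).1 h3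
  set B := {ω | logLikelihoodSum p₀ p₁ m ω < -4}
  have hB : MeasurableSet B := measurableSet_lt hSm measurable_const
  have hBs : MeasurableSet (shift n ⁻¹' B) := measurable_shift n hB
  -- Off the shifted `B` the likelihood ratio is at least e^{-4}.
  have h1 : e * P (E \ shift n ⁻¹' B) ≤ changeMeasure μ p₀ p₁ (n + 1) E := by
    rw [changeMeasure_apply h₀ h₁ hpos₀ hpos₁ hE, ← setLIntegral_const]
    refine (setLIntegral_mono_ae' (hEm.diff hBs) (ae_of_all _ fun ω hω => ?_)).trans
      (lintegral_mono_set Set.sdiff_subset)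
    exact ENNReal.ofReal_le_ofReal (Real.exp_le_exp.2 (not_lt.1 hω.2))
  have h2 : P (E \ shift n ⁻¹' B) ≤ 1 / 4 * P A := by
    have : e * P (E \ shift n ⁻¹' B) ≤ e * (1 / 4 * P A) := by
      refine (h1.trans hPt).trans_eq ?_
      rw [← mul_assoc, mul_one_div]
    exact (ENNReal.mul_le_mul_iff_right he0 het).1 this
  -- The bad event depends on observations after n, hence is independent of `A`.
  have h3 : P (A ∩ shift n ⁻¹' B) ≤ 1 / 2 * P A := by
    rw [iidMeasure_inter_shift h₀ hA hB, mul_comm]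
    gcongr
    exact iidMeasure_logLikelihoodSum_lt_le h₀ h₁ hpos₀ hpos₁ hD hm
  calc P E ≤ P ((E \ shift n ⁻¹' B) ∪ (A ∩ shift n ⁻¹' B)) := by
        refine measure_mono fun ω hω => ?_
        by_cases h : ω ∈ shift n ⁻¹' B
        · exact Or.inr ⟨hEA hω, h⟩
        · exact Or.inl ⟨hω, h⟩
    _ ≤ 1 / 4 * P A + 1 / 2 * P A := (measure_union_le _ _).trans (add_le_add h2 h3)
    _ = 3 / 4 * P A := by
        rw [← add_mul]
        congr 1
        rw [← ENNReal.toReal_eq_toReal_iff' (by finiteness) (by finiteness),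
          ENNReal.toReal_add (by finiteness) (by finiteness)]
        norm_num

theorem lintegral_eq_tsum_measure_lt {Ω : Type*} [MeasurableSpace Ω] (P : Measure Ω)
    {T : Ω → ℕ∞} (hT : ∀ n : ℕ, MeasurableSet {ω | (n : ℕ∞) < T ω}) :
    ∫⁻ ω, (T ω : ℝ≥0∞) ∂P = ∑' n : ℕ, P {ω | (n : ℕ∞) < T ω} := by
  simp_rw [toENNReal_eq_tsum]
  rw [lintegral_tsum fun n => (Measurable.ite (hT n) measurable_const measurable_const).aemeasurable]
  congr 1
  ext1 n
  rw [← lintegral_indicator_one (hT n)]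
  simp only [Set.indicator_apply, Set.mem_ofPred_eq, Pi.one_apply]

theorem le_optimalDelay (h₀ : IsPDF μ p₀) (h₁ : IsPDF μ p₁)
    (hpos₀ : ∀ᵐ x ∂law μ p₀, 0 < p₀ x ∧ 0 < p₁ x)
    (hpos₁ : ∀ᵐ x ∂law μ p₁, 0 < p₀ x ∧ 0 < p₁ x) (hD : D μ p₀ p₁ ≠ ∞) {m : ℕ} (hm0 : 0 < m)
    (hm : m * (D μ p₀ p₁).toReal ≤ 1) {γ : ℝ} (hγ : 4 * m < γ) :
    m * ENNReal.ofReal (Real.exp (-4)) / 4 ≤ optimalDelay μ p₀ p₁ γ := by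
  have := isProbabilityMeasure_iidMeasure h₀
  refine le_iInf fun T => le_iInf fun hT => le_iInf fun hE => ?_
  by_contra! hlt
  have h := tsum_le_of_add_le (fun _ => prob_le_one)
    (iidMeasure_lt_add_le h₀ h₁ hpos₀ hpos₁ hD hm0 hm hT hlt.le)
  rw [← lintegral_eq_tsum_measure_lt _ fun n =>
    (history 𝓧).le n _ (measurableSet_lt_of_isStoppingTime hT n)] at h
  have h2 := hE.trans h
  have h3 : (4 * m : ℝ≥0∞) = ENNReal.ofReal (4 * m) := by
    rw [ENNReal.ofReal_mul (by norm_num)]; simp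
  rw [h3, ENNReal.ofReal_le_ofReal_iff (by positivity)] at h2
  linarith

end LowerBound

/-! ### The sequential probability ratio test: error probabilities and exponential tail. -/

section SPRT

theorem natCast_lt_sprtTime_iff {𝓧 : Type*} {p₀ p₁ : 𝓧 → ℝ} {a b : ℝ} {ω : ℕ → 𝓧} {k : ℕ} :
    (k : ℕ∞) < sprtTime p₀ p₁ a b ω ↔
      ∀ j, 1 ≤ j → j ≤ k → logLikelihoodSum p₀ p₁ j ω ∈ Set.Ioo a b := by
  rw [← ENat.add_one_le_iff (ENat.natCast_ne_top k), sprtTime]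
  simp only [le_iInf_iff]
  constructor
  · intro h j h1 hjk
    by_contra hj
    have := h j ⟨h1, hj⟩
    norm_cast at this
    omega
  · rintro h j ⟨h1, hj⟩
    by_contra hlt
    exact hj (h j h1 (by norm_cast at hlt; omega))

theorem logLikelihoodSum_notMem_of_sprtTime_eq {𝓧 : Type*} {p₀ p₁ : 𝓧 → ℝ} {a b : ℝ}
    {ω : ℕ → 𝓧} {k : ℕ} (h : sprtTime p₀ p₁ a b ω = k) :
    1 ≤ k ∧ logLikelihoodSum p₀ p₁ k ω ∉ Set.Ioo a b := by
  have h1 : ¬ (k : ℕ∞) < sprtTime p₀ p₁ a b ω := by rw [h]; exact lt_irrefl _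
  rw [natCast_lt_sprtTime_iff] at h1
  push Not at h1
  obtain ⟨j, hj1, hjk, hj⟩ := h1
  have h2 : (k : ℕ∞) ≤ j := by
    rw [← h]
    exact iInf₂_le j ⟨hj1, hj⟩
  have : j = k := le_antisymm hjk (by exact_mod_cast h2)
  subst this
  exact ⟨hj1, hj⟩

theorem lt_logLikelihoodSum_of_lt_sprtTime {𝓧 : Type*} {p₀ p₁ : 𝓧 → ℝ} {a b : ℝ} (ha : a < 0)
    {ω : ℕ → 𝓧} {k : ℕ} (h : (k : ℕ∞) < sprtTime p₀ p₁ a b ω) :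
    a < logLikelihoodSum p₀ p₁ k ω := by
  rcases Nat.eq_zero_or_pos k with rfl | hk
  · simpa [logLikelihoodSum] using ha
  · exact (natCast_lt_sprtTime_iff.1 h k hk le_rfl).1

variable {𝓧 : Type*} [MeasurableSpace 𝓧] {μ : Measure 𝓧} {p₀ p₁ : 𝓧 → ℝ}

theorem isStoppingTime_sprtTime (h₀ : IsPDF μ p₀) (h₁ : IsPDF μ p₁) (a b : ℝ) :
    IsStoppingTime (history 𝓧) (sprtTime p₀ p₁ a b) := by
  intro k
  have : {ω | sprtTime p₀ p₁ a b ω ≤ (k : ℕ∞)} =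
      (⋂ j, ⋂ (_ : 1 ≤ j ∧ j ≤ k), logLikelihoodSum p₀ p₁ j ⁻¹' Set.Ioo a b)ᶜ := by
    ext ω
    have := (natCast_lt_sprtTime_iff (p₀ := p₀) (p₁ := p₁) (a := a) (b := b) (ω := ω) (k := k)).not
    rw [not_lt] at this
    simpa only [Set.mem_ofPred_eq, Set.mem_compl_iff, Set.mem_iInter, Set.mem_preimage,
      and_imp] using this
  refine (congrArg (MeasurableSet[history 𝓧 k]) this).mpr ?_
  refine MeasurableSet.compl (MeasurableSet.iInter fun j => MeasurableSet.iInter fun hj => ?_)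
  exact measurable_logLikelihoodSum_history h₀ h₁ hj.2 measurableSet_Ioo

theorem measurable_sprtTime (h₀ : IsPDF μ p₀) (h₁ : IsPDF μ p₁) (a b : ℝ) :
    Measurable (sprtTime p₀ p₁ a b) := by
  have hτ := isStoppingTime_sprtTime h₀ h₁ a b
  refine measurable_to_countable' fun y => ?_
  induction y using ENat.recTopCoe with
  | top =>
    have : sprtTime p₀ p₁ a b ⁻¹' {⊤} = ⋂ n : ℕ, {ω | (n : ℕ∞) < sprtTime p₀ p₁ a b ω} := by
      ext ω
      simp [ENat.eq_top_iff_forall_gt]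
    rw [this]
    exact MeasurableSet.iInter fun n =>
      (history 𝓧).le n _ (measurableSet_lt_of_isStoppingTime hτ n)
  | coe n => exact (history 𝓧).le n _ (hτ.measurableSet_eq n)

theorem measurable_sprtValue (h₀ : IsPDF μ p₀) (h₁ : IsPDF μ p₁) (a b : ℝ) :
    Measurable (sprtValue p₀ p₁ a b) := by
  have h : Measurable fun x : ℕ × (ℕ → 𝓧) => logLikelihoodSum p₀ p₁ x.1 x.2 :=
    measurable_from_prod_countable_right fun k => measurable_logLikelihoodSum h₀ h₁ k
  exact h.comp (((Measurable.of_discrete (f := ENat.toNat)).comp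
    (measurable_sprtTime h₀ h₁ a b)).prodMk measurable_id)

/-- Wald's error bound: on `E k` the likelihood ratio at time k is at most e^c, and disjointness
lets the `p₀`-probabilities sum to at most 1. The events will be exits at time k, each with its own
horizon. -/
theorem iidMeasure_biUnion_le_of_le (h₀ : IsPDF μ p₀) (h₁ : IsPDF μ p₁)
    (hpos₀ : ∀ᵐ x ∂law μ p₀, 0 < p₀ x ∧ 0 < p₁ x)
    (hpos₁ : ∀ᵐ x ∂law μ p₁, 0 < p₀ x ∧ 0 < p₁ x) {E : ℕ → Set (ℕ → 𝓧)}
    (hE : ∀ k, MeasurableSet[history 𝓧 k] (E k)) (hd : Pairwise (Function.onFun Disjoint E))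
    {c : ℝ} (hc : ∀ k, ∀ ω ∈ E k, logLikelihoodSum p₀ p₁ k ω ≤ c) (s : Finset ℕ) :
    iidMeasure μ p₁ (⋃ k ∈ s, E k) ≤ ENNReal.ofReal (Real.exp c) := by
  have := isProbabilityMeasure_iidMeasure h₀
  have hEm : ∀ k, MeasurableSet (E k) := fun k => (history 𝓧).le k _ (hE k)
  refine (measure_biUnion_finset_le _ _).trans ?_
  calc ∑ k ∈ s, iidMeasure μ p₁ (E k)
      ≤ ∑ k ∈ s, ENNReal.ofReal (Real.exp c) * iidMeasure μ p₀ (E k) := by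
        refine Finset.sum_le_sum fun k _ => ?_
        rw [iidMeasure_apply h₀ h₁ hpos₀ hpos₁ (hE k), ← setLIntegral_const]
        exact setLIntegral_mono_ae' (hEm k) (ae_of_all _ fun ω hω =>
          ENNReal.ofReal_le_ofReal (Real.exp_le_exp.2 (hc k ω hω)))
    _ = ENNReal.ofReal (Real.exp c) * iidMeasure μ p₀ (⋃ k ∈ s, E k) := by
        rw [← Finset.mul_sum, measure_biUnion_finset (hd.set_pairwise _) fun k _ => hEm k]
    _ ≤ ENNReal.ofReal (Real.exp c) * 1 := by gcongr; exact prob_le_one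
    _ = _ := mul_one _

theorem iidMeasure_biUnion_le_of_ge (h₀ : IsPDF μ p₀) (h₁ : IsPDF μ p₁)
    (hpos₀ : ∀ᵐ x ∂law μ p₀, 0 < p₀ x ∧ 0 < p₁ x)
    (hpos₁ : ∀ᵐ x ∂law μ p₁, 0 < p₀ x ∧ 0 < p₁ x) {E : ℕ → Set (ℕ → 𝓧)}
    (hE : ∀ k, MeasurableSet[history 𝓧 k] (E k)) (hd : Pairwise (Function.onFun Disjoint E))
    {c : ℝ} (hc : ∀ k, ∀ ω ∈ E k, c ≤ logLikelihoodSum p₀ p₁ k ω) (s : Finset ℕ) :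
    iidMeasure μ p₀ (⋃ k ∈ s, E k) ≤ ENNReal.ofReal (Real.exp (-c)) := by
  have := isProbabilityMeasure_iidMeasure h₁
  have hEm : ∀ k, MeasurableSet (E k) := fun k => (history 𝓧).le k _ (hE k)
  have key : ENNReal.ofReal (Real.exp c) * iidMeasure μ p₀ (⋃ k ∈ s, E k) ≤ 1 := by
    calc ENNReal.ofReal (Real.exp c) * iidMeasure μ p₀ (⋃ k ∈ s, E k)
        = ∑ k ∈ s, ENNReal.ofReal (Real.exp c) * iidMeasure μ p₀ (E k) := by
          rw [← Finset.mul_sum, measure_biUnion_finset (hd.set_pairwise _) fun k _ => hEm k]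
      _ ≤ ∑ k ∈ s, iidMeasure μ p₁ (E k) := by
          refine Finset.sum_le_sum fun k _ => ?_
          rw [iidMeasure_apply h₀ h₁ hpos₀ hpos₁ (hE k), ← setLIntegral_const]
          exact setLIntegral_mono_ae' (hEm k) (ae_of_all _ fun ω hω =>
            ENNReal.ofReal_le_ofReal (Real.exp_le_exp.2 (hc k ω hω)))
      _ = iidMeasure μ p₁ (⋃ k ∈ s, E k) := by
          rw [measure_biUnion_finset (hd.set_pairwise _) fun k _ => hEm k]
      _ ≤ 1 := prob_le_one
  rw [Real.exp_neg, ENNReal.ofReal_inv_of_pos (Real.exp_pos c)]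
  rw [mul_comm] at key
  exact ENNReal.le_inv_iff_mul_le.2 key

/-- The Bhattacharyya coefficient of two distinct densities is less than one. -/
theorem lintegral_sqrt_div_lt_one (h₀ : IsPDF μ p₀) (h₁ : IsPDF μ p₁)
    (hpos₁ : ∀ᵐ x ∂law μ p₁, 0 < p₀ x ∧ 0 < p₁ x) (hne : ¬ p₁ =ᵐ[μ] p₀) :
    ∫⁻ x, ENNReal.ofReal (√(p₁ x / p₀ x)) ∂law μ p₀ < 1 := by
  have m₀ := h₀.measurable
  have m₁ := h₁.measurable
  have := h₀.isProbabilityMeasure_law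
  have := h₁.isProbabilityMeasure_law
  by_contra! hge
  refine hne ?_
  have hlaw := law_eq_withDensity h₀ h₁ hpos₁
  have hr : ∫⁻ x, ENNReal.ofReal (p₁ x / p₀ x) ∂law μ p₀ = 1 := by
    rw [← setLIntegral_univ, ← withDensity_apply _ MeasurableSet.univ, ← hlaw, measure_univ]
  -- With r the density ratio, (1 - √r)² has mean 2 - 2ρ, where ρ is the coefficient. If ρ ≥ 1 this
  -- mean vanishes, so r = 1 almost surely and the densities agree.
  have hid : ∀ x, ENNReal.ofReal ((1 - √(p₁ x / p₀ x)) ^ 2) + 2 * ENNReal.ofReal (√(p₁ x / p₀ x)) =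
      1 + ENNReal.ofReal (p₁ x / p₀ x) := fun x => by
    have h : 0 ≤ p₁ x / p₀ x := div_nonneg (h₁.nonneg x) (h₀.nonneg x)
    rw [show (2 : ℝ≥0∞) = ENNReal.ofReal 2 by simp, ← ENNReal.ofReal_mul (by norm_num),
      ← ENNReal.ofReal_add (by positivity) (by positivity), ← ENNReal.ofReal_one,
      ← ENNReal.ofReal_add (by norm_num) h]
    congr 1
    nlinarith [Real.sq_sqrt h]
  have hsum : ∫⁻ x, ENNReal.ofReal ((1 - √(p₁ x / p₀ x)) ^ 2) ∂law μ p₀ +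
      2 * ∫⁻ x, ENNReal.ofReal (√(p₁ x / p₀ x)) ∂law μ p₀ = 1 + 1 := by
    rw [← lintegral_const_mul _ (by fun_prop), ← lintegral_add_left (by fun_prop)]
    simp_rw [hid]
    rw [lintegral_add_left measurable_const, hr]
    simp
  have hzero : ∫⁻ x, ENNReal.ofReal ((1 - √(p₁ x / p₀ x)) ^ 2) ∂law μ p₀ = 0 := by
    have h2 : ∫⁻ x, ENNReal.ofReal ((1 - √(p₁ x / p₀ x)) ^ 2) ∂law μ p₀ + 2 ≤ 0 + 2 := by
      calc _ ≤ ∫⁻ x, ENNReal.ofReal ((1 - √(p₁ x / p₀ x)) ^ 2) ∂law μ p₀ +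
            2 * ∫⁻ x, ENNReal.ofReal (√(p₁ x / p₀ x)) ∂law μ p₀ := by
            gcongr
            simpa using mul_le_mul_right hge 2
        _ = 0 + 2 := by rw [hsum]; norm_num
    exact le_antisymm ((ENNReal.add_le_add_iff_right (by norm_num)).1 h2) zero_le
  rw [lintegral_eq_zero_iff (by fun_prop)] at hzero
  have hone : (fun x => ENNReal.ofReal (p₁ x / p₀ x)) =ᵐ[law μ p₀] 1 := by
    filter_upwards [hzero] with x hx
    have h : 0 ≤ p₁ x / p₀ x := div_nonneg (h₁.nonneg x) (h₀.nonneg x)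
    have h2 : (1 - √(p₁ x / p₀ x)) ^ 2 ≤ 0 := ENNReal.ofReal_eq_zero.1 hx
    have h3 : 1 - √(p₁ x / p₀ x) = 0 :=
      pow_eq_zero_iff two_ne_zero |>.1 (le_antisymm h2 (sq_nonneg _))
    have h4 : p₁ x / p₀ x = 1 := by rw [← Real.sq_sqrt h]; nlinarith
    simp [h4]
  rw [withDensity_congr_ae hone, withDensity_one, law, law,
    withDensity_eq_iff (by fun_prop) (by fun_prop) (by rw [h₁.lintegral_eq_one]; simp)] at hlaw
  filter_upwards [hlaw] with x hx
  exact (ENNReal.ofReal_eq_ofReal_iff (h₁.nonneg x) (h₀.nonneg x)).1 hx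

/-- While the test runs, S_k > a, so 1 ≤ e^{-a/2} e^{S_k/2}; by independence the mean of e^{S_k/2}
is the k-th power of the Bhattacharyya coefficient. -/
theorem iidMeasure_lt_sprtTime_le (h₀ : IsPDF μ p₀) (h₁ : IsPDF μ p₁)
    (hpos₀ : ∀ᵐ x ∂law μ p₀, 0 < p₀ x ∧ 0 < p₁ x) {a b : ℝ} (ha : a < 0) (k : ℕ) :
    iidMeasure μ p₀ {ω | (k : ℕ∞) < sprtTime p₀ p₁ a b ω} ≤
      ENNReal.ofReal (Real.exp (-a / 2)) *
        (∫⁻ x, ENNReal.ofReal (√(p₁ x / p₀ x)) ∂law μ p₀) ^ k := by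
  have m₀ := h₀.measurable
  have m₁ := h₁.measurable
  have := h₀.isProbabilityMeasure_law
  have hg : Measurable fun x => ENNReal.ofReal (√(p₁ x / p₀ x)) := by fun_prop
  have hprod : ∫⁻ ω, ∏ i ∈ Finset.range k, ENNReal.ofReal (√(p₁ (ω i) / p₀ (ω i)))
      ∂iidMeasure μ p₀ = (∫⁻ x, ENNReal.ofReal (√(p₁ x / p₀ x)) ∂law μ p₀) ^ k := by
    rw [iidMeasure, lintegral_prod_eq_prod_lintegral_of_indepFun _ _
      (iIndepFun_infinitePi (P := fun _ => law μ p₀)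
        (X := fun _ x => ENNReal.ofReal (√(p₁ x / p₀ x))) fun _ => hg)
      (fun i => hg.comp (measurable_pi_apply i))]
    rw [Finset.prod_congr rfl (g := fun _ => ∫⁻ x, ENNReal.ofReal (√(p₁ x / p₀ x)) ∂law μ p₀)
      (fun i _ => by
        conv_rhs => rw [← Measure.infinitePi_map_eval (fun _ => law μ p₀) i]
        rw [lintegral_map hg (measurable_pi_apply i)])]
    simp
  have hms := (history 𝓧).le k _
    (measurableSet_lt_of_isStoppingTime (isStoppingTime_sprtTime h₀ h₁ a b) k)
  rw [← hprod, ← lintegral_const_mul _ (by fun_prop), ← lintegral_indicator_one hms]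
  refine lintegral_mono_ae ?_
  filter_upwards [ae_iidMeasure_forall h₀ hpos₀] with ω hω
  by_cases h : (k : ℕ∞) < sprtTime p₀ p₁ a b ω
  swap
  · rw [Set.indicator_of_notMem (by exact h)]
    exact zero_le
  rw [Set.indicator_of_mem (by exact h)]
  have hS := lt_logLikelihoodSum_of_lt_sprtTime ha h
  rw [← ENNReal.ofReal_prod_of_nonneg (fun i _ => Real.sqrt_nonneg _),
    ← ENNReal.ofReal_mul (Real.exp_pos _).le, Pi.one_apply, ENNReal.one_le_ofReal]
  have hsq : ∏ i ∈ Finset.range k, √(p₁ (ω i) / p₀ (ω i)) =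
      Real.exp (logLikelihoodSum p₀ p₁ k ω / 2) := by
    rw [Real.exp_half, exp_logLikelihoodSum hω,
      Real.sqrt_prod _ fun i _ => div_nonneg (h₁.nonneg _) (h₀.nonneg _)]
  rw [hsq, ← Real.exp_add, Real.one_le_exp_iff]
  linarith

end SPRT

/-! ### Wald's identity and the tail of the test in terms of D. -/

section Wald

variable {𝓧 : Type*} [MeasurableSpace 𝓧] {μ : Measure 𝓧} {p₀ p₁ : 𝓧 → ℝ}

theorem setLIntegral_eval (h₀ : IsPDF μ p₀) {f : 𝓧 → ℝ≥0∞} (hf : Measurable f) {k : ℕ}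
    {A : Set (ℕ → 𝓧)} (hA : MeasurableSet[history 𝓧 k] A) :
    ∫⁻ ω in A, f (ω k) ∂iidMeasure μ p₀ = iidMeasure μ p₀ A * ∫⁻ x, f x ∂law μ p₀ := by
  have := h₀.isProbabilityMeasure_law
  have hAm := (history 𝓧).le k A hA
  have hone : Measurable[history 𝓧 k] (1 : (ℕ → 𝓧) → ℝ≥0∞) :=
    @measurable_const _ _ _ (history 𝓧 k) 1
  have h := lintegral_mul_eq_lintegral_mul_lintegral_of_independent_measurableSpace
    ((history 𝓧).le k) (measurable_shift k).comap_le
    (indep_history_shift (ν := fun _ => law μ p₀) k)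
    (f := A.indicator 1) (g := fun ω => f (ω k))
    (hone.indicator hA)
    ((hf.comp (measurable_pi_apply 0)).comp (comap_measurable (shift k)))
  have e : ∫⁻ ω, f (ω k) ∂iidMeasure μ p₀ = ∫⁻ x, f x ∂law μ p₀ := by
    conv_rhs => rw [← Measure.infinitePi_map_eval (fun _ => law μ p₀) k]
    rw [lintegral_map hf (measurable_pi_apply k)]
    rfl
  rw [← e, ← lintegral_indicator hAm, ← lintegral_indicator_one hAm]
  refine Eq.trans ?_ h
  congr 1
  ext ω
  by_cases hω : ω ∈ A <;> simp [hω]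

theorem setIntegral_eval (h₀ : IsPDF μ p₀) {f : 𝓧 → ℝ} (hf : Measurable f)
    (hfi : Integrable f (law μ p₀)) {k : ℕ} {A : Set (ℕ → 𝓧)}
    (hA : MeasurableSet[history 𝓧 k] A) :
    ∫ ω in A, f (ω k) ∂iidMeasure μ p₀ =
      (iidMeasure μ p₀).real A * ∫ x, f x ∂law μ p₀ := by
  have := h₀.isProbabilityMeasure_law
  have := isProbabilityMeasure_iidMeasure h₀
  have h := condExp_indep_eq (f := fun ω : ℕ → 𝓧 => f (ω k)) (μ := iidMeasure μ p₀)
    (measurable_shift k).comap_le ((history 𝓧).le k)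
    (((hf.comp (measurable_pi_apply 0)).comp (comap_measurable (shift k))).stronglyMeasurable)
    (indep_history_shift (ν := fun _ => law μ p₀) k).symm
  rw [← setIntegral_condExp ((history 𝓧).le k) (integrable_eval h₀ hfi k) hA,
    integral_congr_ae (ae_restrict_of_ae h), setIntegral_const, integral_eval h₀ hfi, smul_eq_mul]

theorem tsum_iidMeasure_lt_sprtTime_ne_top (h₀ : IsPDF μ p₀) (h₁ : IsPDF μ p₁)
    (hpos₀ : ∀ᵐ x ∂law μ p₀, 0 < p₀ x ∧ 0 < p₁ x)
    (hpos₁ : ∀ᵐ x ∂law μ p₁, 0 < p₀ x ∧ 0 < p₁ x) (hne : ¬ p₁ =ᵐ[μ] p₀) {a b : ℝ} (ha : a < 0) :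
    ∑' k : ℕ, iidMeasure μ p₀ {ω | (k : ℕ∞) < sprtTime p₀ p₁ a b ω} ≠ ∞ := by
  refine ne_top_of_le_ne_top ?_
    (ENNReal.tsum_le_tsum fun k => iidMeasure_lt_sprtTime_le h₀ h₁ hpos₀ (b := b) ha k)
  rw [ENNReal.tsum_mul_left, ENNReal.tsum_geometric]
  refine ENNReal.mul_ne_top ENNReal.ofReal_ne_top (ENNReal.inv_ne_top.2 ?_)
  exact (tsub_pos_of_lt (lintegral_sqrt_div_lt_one h₀ h₁ hpos₁ hne)).ne'

/-- A non-integrable overshoot would have Bochner integral 0, and the overshoot assumption would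
then say nothing. The stopped walk is dominated by the sum of |log-ratio| over the steps before
stopping. Since {k < τ} is independent of observation k + 1, the mean of this sum is E[τ] times a
finite first moment. -/
theorem integrable_indicator_sprtValue (h₀ : IsPDF μ p₀) (h₁ : IsPDF μ p₁)
    (hpos₀ : ∀ᵐ x ∂law μ p₀, 0 < p₀ x ∧ 0 < p₁ x)
    (hpos₁ : ∀ᵐ x ∂law μ p₁, 0 < p₀ x ∧ 0 < p₁ x) (hne : ¬ p₁ =ᵐ[μ] p₀)
    (hD : D μ p₀ p₁ ≠ ∞) {a b : ℝ} (ha : a < 0) :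
    Integrable ({ω | sprtValue p₀ p₁ a b ω ≤ a}.indicator fun ω => sprtValue p₀ p₁ a b ω - a)
      (iidMeasure μ p₀) := by
  have m₀ := h₀.measurable
  have m₁ := h₁.measurable
  have := isProbabilityMeasure_iidMeasure h₀
  have hv := measurable_sprtValue h₀ h₁ a b
  set τ := sprtTime p₀ p₁ a b with hτ
  set f : 𝓧 → ℝ := fun x => Real.log (p₁ x / p₀ x)
  have hf : Measurable f := by fun_prop
  have hfi : Integrable f (law μ p₀) := (integrable_log_and_toReal_D h₀ h₁ hpos₀ hD).1
  have hs : ∀ k : ℕ, MeasurableSet[history 𝓧 k] {ω | (k : ℕ∞) < τ ω} := fun k =>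
    measurableSet_lt_of_isStoppingTime (isStoppingTime_sprtTime h₀ h₁ a b) k
  have hsm : ∀ k : ℕ, MeasurableSet {ω | (k : ℕ∞) < τ ω} := fun k => (history 𝓧).le k _ (hs k)
  refine ⟨((hv.sub_const a).indicator (measurableSet_le hv measurable_const)).aestronglyMeasurable,
    ?_⟩
  have hbound : ∀ ω, ‖({ω | sprtValue p₀ p₁ a b ω ≤ a}.indicator
      fun ω => sprtValue p₀ p₁ a b ω - a) ω‖ₑ ≤
      ‖a‖ₑ + ∑' k : ℕ, {ω | (k : ℕ∞) < τ ω}.indicator (fun ω => ‖f (ω k)‖ₑ) ω := by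
    intro ω
    refine (enorm_indicator_le_enorm_self _ _).trans ?_
    rw [add_comm]
    refine (enorm_sub_le).trans (add_le_add ?_ le_rfl)
    unfold sprtValue logLikelihoodSum
    refine (enorm_sum_le _ _).trans ?_
    refine le_trans (Finset.sum_le_sum fun k hk => ?_) (ENNReal.sum_le_tsum
      (Finset.range (τ ω).toNat))
    rw [Set.indicator_of_mem]
    have hk : k < (τ ω).toNat := Finset.mem_range.1 hk
    exact lt_of_lt_of_le (Nat.cast_lt.2 hk) (ENat.natCast_toNat_le_self _)
  rw [hasFiniteIntegral_iff_enorm]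
  refine lt_of_le_of_lt (lintegral_mono hbound) ?_
  rw [lintegral_add_left measurable_const, lintegral_tsum fun k =>
    (Measurable.indicator (by fun_prop) (hsm k)).aemeasurable]
  have : ∀ k : ℕ, ∫⁻ ω, {ω | (k : ℕ∞) < τ ω}.indicator (fun ω => ‖f (ω k)‖ₑ) ω ∂iidMeasure μ p₀ =
      iidMeasure μ p₀ {ω | (k : ℕ∞) < τ ω} * ∫⁻ x, ‖f x‖ₑ ∂law μ p₀ := fun k => by
    rw [lintegral_indicator (hsm k)]
    exact setLIntegral_eval h₀ (f := fun x => ‖f x‖ₑ) (by fun_prop) (hs k)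
  simp_rw [this]
  rw [ENNReal.tsum_mul_right, lintegral_const, measure_univ, mul_one]
  refine ENNReal.add_lt_top.2 ⟨enorm_lt_top, ENNReal.mul_lt_top ?_ hfi.2⟩
  exact (tsum_iidMeasure_lt_sprtTime_ne_top h₀ h₁ hpos₀ hpos₁ hne ha).lt_top

/-- A consequence of Wald's identity for the stopped log-likelihood walk. -/
theorem mul_toReal_D_le (h₀ : IsPDF μ p₀) (h₁ : IsPDF μ p₁)
    (hpos₀ : ∀ᵐ x ∂law μ p₀, 0 < p₀ x ∧ 0 < p₁ x)
    (hpos₁ : ∀ᵐ x ∂law μ p₁, 0 < p₀ x ∧ 0 < p₁ x) (hne : ¬ p₁ =ᵐ[μ] p₀)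
    (hD : D μ p₀ p₁ ≠ ∞) {a b : ℝ} (ha : a < 0)
    (hover : |∫ ω, (sprtValue p₀ p₁ a b ω - a)
      ∂(cond (iidMeasure μ p₀) {ω | sprtValue p₀ p₁ a b ω ≤ a})| ≤ 1) (n : ℕ) :
    n * (iidMeasure μ p₀).real {ω | (n : ℕ∞) < sprtTime p₀ p₁ a b ω} * (D μ p₀ p₁).toReal ≤
      1 - a := by
  have m₀ := h₀.measurable
  have m₁ := h₁.measurable
  have := isProbabilityMeasure_iidMeasure h₀
  have hv := measurable_sprtValue h₀ h₁ a b
  set P := iidMeasure μ p₀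
  set τ := sprtTime p₀ p₁ a b with hτ
  set f : 𝓧 → ℝ := fun x => Real.log (p₁ x / p₀ x)
  have hf : Measurable f := by fun_prop
  obtain ⟨hfi, hfv⟩ := integrable_log_and_toReal_D h₀ h₁ hpos₀ hD
  have hs : ∀ k : ℕ, MeasurableSet[history 𝓧 k] {ω | (k : ℕ∞) < τ ω} := fun k =>
    measurableSet_lt_of_isStoppingTime (isStoppingTime_sprtTime h₀ h₁ a b) k
  have hsm : ∀ k : ℕ, MeasurableSet {ω | (k : ℕ∞) < τ ω} := fun k => (history 𝓧).le k _ (hs k)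
  set A := {ω | sprtValue p₀ p₁ a b ω ≤ a}
  have hA : MeasurableSet A := measurableSet_le hv measurable_const
  set G := A.indicator fun ω => sprtValue p₀ p₁ a b ω - a
  have hG : Integrable G P := integrable_indicator_sprtValue h₀ h₁ hpos₀ hpos₁ hne hD ha
  -- Passing from the conditional to the restricted integral multiplies by P(A) ≤ 1. If P(A) = 0 the
  -- conditional measure is no probability measure, but the restricted integral is 0.
  have hGval : -1 ≤ ∫ ω, G ω ∂P := by
    rw [integral_indicator hA]
    rw [ProbabilityTheory.cond, integral_smul_measure, smul_eq_mul] at hover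
    rcases eq_or_ne (P A) 0 with h0 | h0
    · rw [Measure.restrict_eq_zero.2 h0]; simp
    · have hp : 0 < (P A).toReal := ENNReal.toReal_pos h0 (measure_ne_top _ _)
      rw [ENNReal.toReal_inv, abs_mul, abs_of_pos (inv_pos.2 hp), inv_mul_le_iff₀ hp, mul_one]
        at hover
      have h1 : (P A).toReal ≤ 1 := by
        have := measureReal_le_one (μ := P) (s := A)
        exact this
      linarith [neg_abs_le (∫ ω in A, (sprtValue p₀ p₁ a b ω - a) ∂P)]
  have hGnonpos : ∀ ω, G ω ≤ 0 := fun ω => by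
    by_cases h : ω ∈ A
    · have h' : sprtValue p₀ p₁ a b ω ≤ a := h
      simp only [G, Set.indicator_of_mem h]; linarith
    · simp only [G, Set.indicator_of_notMem h]; exact le_rfl
  -- The right side is the walk stopped at min(τ, n). It exceeds a unless the walk has exited below
  -- by time n, and then it equals a plus the overshoot.
  have hpt : ∀ ω, a + G ω ≤
      ∑ k ∈ Finset.range n, {ω | (k : ℕ∞) < τ ω}.indicator (fun ω => f (ω k)) ω := by
    intro ω
    by_cases hn : (n : ℕ∞) < τ ω
    · have e : ∑ k ∈ Finset.range n, {ω | (k : ℕ∞) < τ ω}.indicator (fun ω => f (ω k)) ω =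
          logLikelihoodSum p₀ p₁ n ω := by
        refine Finset.sum_congr rfl fun k hk => Set.indicator_of_mem ?_ _
        refine lt_trans (b := (n : ℕ∞)) ?_ hn
        exact_mod_cast Finset.mem_range.1 hk
      rw [e]
      linarith [hGnonpos ω, lt_logLikelihoodSum_of_lt_sprtTime ha hn]
    · obtain ⟨N, hN⟩ : ∃ N : ℕ, τ ω = N :=
        ⟨(τ ω).toNat, (ENat.natCast_toNat
          (ne_top_of_le_ne_top (ENat.natCast_ne_top n) (not_lt.1 hn))).symm⟩
      have hNn : N ≤ n := by
        rw [hN] at hn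
        exact_mod_cast not_lt.1 hn
      have e : ∑ k ∈ Finset.range n, {ω | (k : ℕ∞) < τ ω}.indicator (fun ω => f (ω k)) ω =
          logLikelihoodSum p₀ p₁ N ω := by
        rw [← Finset.sum_subset (Finset.range_subset_range.2 hNn)]
        · refine Finset.sum_congr rfl fun k hk => Set.indicator_of_mem ?_ _
          change (k : ℕ∞) < τ ω
          rw [hN]
          exact_mod_cast Finset.mem_range.1 hk
        · intro k _ hk
          refine Set.indicator_of_notMem (fun h => hk ?_) _
          change (k : ℕ∞) < τ ω at h
          rw [hN] at h
          exact Finset.mem_range.2 (by exact_mod_cast h)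
      have hval : sprtValue p₀ p₁ a b ω = logLikelihoodSum p₀ p₁ N ω := by
        rw [sprtValue, ← hτ, hN, ENat.toNat_natCast]
      rw [e, ← hval]
      by_cases h : ω ∈ A
      · simp only [G, Set.indicator_of_mem h]; linarith
      · simp only [G, Set.indicator_of_notMem h]
        have h' : a < sprtValue p₀ p₁ a b ω := not_le.1 h
        linarith
  have hterm : ∀ k : ℕ, Integrable ({ω | (k : ℕ∞) < τ ω}.indicator (fun ω => f (ω k))) P :=
    fun k => (integrable_eval h₀ hfi k).indicator (hsm k)
  have hint := integral_mono ((integrable_const a).add hG)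
    (integrable_finsetSum (Finset.range n) fun k _ => hterm k) hpt
  rw [integral_finsetSum _ fun k _ => hterm k] at hint
  -- Each step has drift -D and is taken with probability P(τ > k) ≥ P(τ > n).
  have hsum : ∑ k ∈ Finset.range n, ∫ ω, {ω | (k : ℕ∞) < τ ω}.indicator (fun ω => f (ω k)) ω ∂P ≤
      n * (P.real {ω | (n : ℕ∞) < τ ω} * -(D μ p₀ p₁).toReal) := by
    rw [← nsmul_eq_mul, ← Finset.card_range n, ← Finset.sum_const]
    simp only [Finset.card_range]
    refine Finset.sum_le_sum fun k hk => ?_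
    rw [integral_indicator (hsm k), setIntegral_eval h₀ hf hfi (hs k), hfv]
    have hsub : P.real {ω | (n : ℕ∞) < τ ω} ≤ P.real {ω | (k : ℕ∞) < τ ω} := by
      refine measureReal_mono fun ω (hω : (n : ℕ∞) < τ ω) => lt_trans (b := (n : ℕ∞)) ?_ hω
      exact_mod_cast Finset.mem_range.1 hk
    have hd : 0 ≤ (D μ p₀ p₁).toReal := ENNReal.toReal_nonneg
    nlinarith
  have hlhs : ∫ ω, (a + G ω) ∂P = a + ∫ ω, G ω ∂P := by
    rw [integral_add (integrable_const a) hG]; simp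
  simp only [Pi.add_apply] at hint
  rw [hlhs] at hint
  nlinarith

end Wald

/-! ### The truncated test as a fixed-length test. -/

section Test

variable {𝓧 : Type*} [MeasurableSpace 𝓧] {μ : Measure 𝓧} {p₀ p₁ : 𝓧 → ℝ}

/-- The event that the sequential probability ratio test exits below `a` by time `L`. -/
def acceptSet {𝓧 : Type*} (p₀ p₁ : 𝓧 → ℝ) (a b : ℝ) (L : ℕ) : Set (ℕ → 𝓧) :=
  ⋃ k ∈ Finset.range (L + 1), {ω | sprtTime p₀ p₁ a b ω = k ∧ logLikelihoodSum p₀ p₁ k ω ≤ a}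

theorem measurableSet_sprtTime_eq_and (h₀ : IsPDF μ p₀) (h₁ : IsPDF μ p₁) (a b : ℝ) {s : Set ℝ}
    (hs : MeasurableSet s) (k : ℕ) :
    MeasurableSet[history 𝓧 k]
      {ω | sprtTime p₀ p₁ a b ω = k ∧ logLikelihoodSum p₀ p₁ k ω ∈ s} :=
  @MeasurableSet.inter _ (history 𝓧 k) _ _
    ((isStoppingTime_sprtTime h₀ h₁ a b).measurableSet_eq k)
    (measurable_logLikelihoodSum_history h₀ h₁ le_rfl hs)

theorem pairwise_disjoint_sprtTime_eq_and {𝓧 : Type*} (p₀ p₁ : 𝓧 → ℝ) (a b : ℝ) (s : Set ℝ) :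
    Pairwise (Function.onFun Disjoint fun k : ℕ =>
      {ω | sprtTime p₀ p₁ a b ω = k ∧ logLikelihoodSum p₀ p₁ k ω ∈ s}) := by
  intro j k hjk
  refine Set.disjoint_left.2 fun ω hj hk => hjk ?_
  have := hj.1.symm.trans hk.1
  exact_mod_cast this

theorem measurableSet_acceptSet (h₀ : IsPDF μ p₀) (h₁ : IsPDF μ p₁) (a b : ℝ) (L : ℕ) :
    MeasurableSet[history 𝓧 L] (acceptSet p₀ p₁ a b L) := by
  refine @Finset.measurableSet_biUnion _ _ (history 𝓧 L) _ _ fun k hk => ?_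
  exact (history 𝓧).mono (Nat.lt_succ_iff.1 (Finset.mem_range.1 hk)) _
    (measurableSet_sprtTime_eq_and h₀ h₁ a b measurableSet_Iic k)

theorem iidMeasure_acceptSet_le (h₀ : IsPDF μ p₀) (h₁ : IsPDF μ p₁)
    (hpos₀ : ∀ᵐ x ∂law μ p₀, 0 < p₀ x ∧ 0 < p₁ x)
    (hpos₁ : ∀ᵐ x ∂law μ p₁, 0 < p₀ x ∧ 0 < p₁ x) (a b : ℝ) (L : ℕ) :
    iidMeasure μ p₁ (acceptSet p₀ p₁ a b L) ≤ ENNReal.ofReal (Real.exp a) :=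
  iidMeasure_biUnion_le_of_le h₀ h₁ hpos₀ hpos₁
    (measurableSet_sprtTime_eq_and h₀ h₁ a b measurableSet_Iic)
    (pairwise_disjoint_sprtTime_eq_and p₀ p₁ a b (Set.Iic a)) (fun _ _ h => h.2) _

/-- Not accepting means being undecided at L or having exited above b; the latter has
`p₀`-probability at most e^{-b} by change of measure. -/
theorem iidMeasure_compl_acceptSet_le (h₀ : IsPDF μ p₀) (h₁ : IsPDF μ p₁)
    (hpos₀ : ∀ᵐ x ∂law μ p₀, 0 < p₀ x ∧ 0 < p₁ x)
    (hpos₁ : ∀ᵐ x ∂law μ p₁, 0 < p₀ x ∧ 0 < p₁ x) (a b : ℝ) (L : ℕ) :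
    iidMeasure μ p₀ (acceptSet p₀ p₁ a b L)ᶜ ≤
      iidMeasure μ p₀ {ω | (L : ℕ∞) < sprtTime p₀ p₁ a b ω} +
        ENNReal.ofReal (Real.exp (-b)) := by
  have hup := iidMeasure_biUnion_le_of_ge h₀ h₁ hpos₀ hpos₁
    (measurableSet_sprtTime_eq_and h₀ h₁ a b measurableSet_Ici)
    (pairwise_disjoint_sprtTime_eq_and p₀ p₁ a b (Set.Ici b)) (fun _ _ h => h.2)
    (Finset.range (L + 1))
  refine (measure_mono fun ω hω => ?_).trans ((measure_union_le _ _).trans (add_le_add le_rfl hup))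
  by_cases hL : (L : ℕ∞) < sprtTime p₀ p₁ a b ω
  · exact Or.inl hL
  right
  obtain ⟨k, hk⟩ : ∃ k : ℕ, sprtTime p₀ p₁ a b ω = k :=
    ⟨(sprtTime p₀ p₁ a b ω).toNat, (ENat.natCast_toNat
      (ne_top_of_le_ne_top (ENat.natCast_ne_top L) (not_lt.1 hL))).symm⟩
  have hkL : k < L + 1 := by
    rw [hk] at hL
    norm_cast at hL
    omega
  refine Set.mem_biUnion (Finset.mem_coe.2 (Finset.mem_range.2 hkL)) ⟨hk, ?_⟩
  have hnot : ¬ logLikelihoodSum p₀ p₁ k ω ≤ a := fun h =>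
    hω (Set.mem_biUnion (Finset.mem_coe.2 (Finset.mem_range.2 hkL)) ⟨hk, h⟩)
  by_contra hb
  exact (logLikelihoodSum_notMem_of_sprtTime_eq hk).2 ⟨not_le.1 hnot, not_le.1 hb⟩

end Test

/-! ### From a fixed-length test to a detection rule by repetition on blocks. -/

section Blocks

/-- The end of the first block of length `L` whose observations lie in `R`. -/
noncomputable def blockTime {𝓧 : Type*} (L : ℕ) (R : Set (ℕ → 𝓧)) (ω : ℕ → 𝓧) : ℕ∞ :=
  ⨅ (j : ℕ) (_ : shift (j * L) ω ∈ R), (((j + 1) * L : ℕ) : ℕ∞)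

theorem natCast_lt_blockTime_iff {𝓧 : Type*} {L : ℕ} {R : Set (ℕ → 𝓧)} {ω : ℕ → 𝓧} {k : ℕ} :
    (k : ℕ∞) < blockTime L R ω ↔ ∀ j, (j + 1) * L ≤ k → shift (j * L) ω ∉ R := by
  rw [← ENat.add_one_le_iff (ENat.natCast_ne_top k), blockTime]
  simp only [le_iInf_iff]
  refine forall_congr' fun j => ?_
  constructor
  · intro h h1 h2
    have := h h2
    norm_cast at this
    omega
  · intro h h1
    by_contra hlt
    exact h (by norm_cast at hlt; omega) h1

/-- At most L steps pass before block `j₀` begins; then L is paid for block `j₀` + i exactly when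
all earlier blocks from `j₀` on were silent. If no block ever alarms, the sum is infinite because L
> 0. -/
theorem toENNReal_blockTime_sub_le {𝓧 : Type*} {L : ℕ} (hL : 0 < L) {R : Set (ℕ → 𝓧)}
    {n j₀ : ℕ} (h : j₀ * L ≤ n + L) (ω : ℕ → 𝓧) :
    ((blockTime L R ω - n : ℕ∞) : ℝ≥0∞) ≤ L + ∑' i : ℕ,
      (⋂ j ∈ Finset.range i, shift ((j₀ + j) * L) ⁻¹' Rᶜ).indicator (fun _ => (L : ℝ≥0∞)) ω := by
  classical
  by_cases hex : ∃ j, shift ((j₀ + j) * L) ω ∈ R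
  · set i := Nat.find hex
    have hi : shift ((j₀ + i) * L) ω ∈ R := Nat.find_spec hex
    have hT : blockTime L R ω ≤ (((j₀ + i + 1) * L : ℕ) : ℕ∞) := iInf₂_le (j₀ + i) hi
    have hT2 : blockTime L R ω - n ≤ ((L + (i + 1) * L : ℕ) : ℕ∞) := by
      refine (tsub_le_tsub_right hT _).trans ?_
      norm_cast
      have : (j₀ + i + 1) * L = j₀ * L + (i + 1) * L := by ring
      omega
    calc ((blockTime L R ω - n : ℕ∞) : ℝ≥0∞) ≤ (((L + (i + 1) * L : ℕ) : ℕ∞) : ℝ≥0∞) :=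
          ENat.toENNReal_le.2 hT2
      _ = L + ∑ k ∈ Finset.range (i + 1), (L : ℝ≥0∞) := by simp
      _ ≤ _ := by
          gcongr
          refine le_trans (Finset.sum_le_sum fun k hk => ?_)
            (ENNReal.sum_le_tsum (Finset.range (i + 1)))
          rw [Set.indicator_of_mem]
          refine Set.mem_iInter₂.2 fun j hj => ?_
          refine Nat.find_min hex (m := j) ?_
          have h1 := Finset.mem_range.1 hj
          have h2 := Finset.mem_range.1 hk
          omega
  · push Not at hex
    have : ∀ i : ℕ, (⋂ j ∈ Finset.range i, shift ((j₀ + j) * L) ⁻¹' Rᶜ).indicator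
        (fun _ => (L : ℝ≥0∞)) ω = L := fun i =>
      Set.indicator_of_mem (Set.mem_iInter₂.2 fun j _ => hex j) _
    simp_rw [this]
    rw [ENNReal.tsum_const_eq_top_of_ne_zero (by exact_mod_cast hL.ne'), add_top]
    exact le_top

variable {𝓧 : Type*} [MeasurableSpace 𝓧] {μ : Measure 𝓧} {p₀ p₁ : 𝓧 → ℝ}

theorem measurableSet_shift_preimage {L k m : ℕ} (h : k + L ≤ m) {R : Set (ℕ → 𝓧)}
    (hR : MeasurableSet[history 𝓧 L] R) : MeasurableSet[history 𝓧 m] (shift k ⁻¹' R) :=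
  (history 𝓧).mono h _ (measurable_shift_history k L hR)

theorem isStoppingTime_blockTime {L : ℕ} {R : Set (ℕ → 𝓧)}
    (hR : MeasurableSet[history 𝓧 L] R) : IsStoppingTime (history 𝓧) (blockTime L R) := by
  intro k
  have : {ω | blockTime L R ω ≤ (k : ℕ∞)} =
      ⋃ j, ⋃ (_ : (j + 1) * L ≤ k), shift (j * L) ⁻¹' R := by
    ext ω
    have h := (natCast_lt_blockTime_iff (L := L) (R := R) (ω := ω) (k := k)).not
    rw [not_lt] at h
    push Not at h
    simpa only [Set.mem_ofPred_eq, Set.mem_iUnion, Set.mem_preimage, exists_prop] using h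
  refine (congrArg (MeasurableSet[history 𝓧 k]) this).mpr ?_
  refine MeasurableSet.iUnion fun j => MeasurableSet.iUnion fun hj => ?_
  exact measurableSet_shift_preimage (by rw [add_mul] at hj; omega) hR

/-- By a union bound the first J blocks are all silent with probability at least 1/2, and then the
alarm comes after time JL. -/
theorem le_lintegral_blockTime (h₀ : IsPDF μ p₀) {L J : ℕ} {R : Set (ℕ → 𝓧)}
    (hR : MeasurableSet[history 𝓧 L] R) (hα : J * iidMeasure μ p₀ R ≤ 1 / 2) :
    ((J * L : ℕ) : ℝ≥0∞) * (1 / 2) ≤ ∫⁻ ω, (blockTime L R ω : ℝ≥0∞) ∂iidMeasure μ p₀ := by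
  have := isProbabilityMeasure_iidMeasure h₀
  have hRm : MeasurableSet R := (history 𝓧).le L R hR
  set U := ⋃ j ∈ Finset.range J, shift (j * L) ⁻¹' R
  have hU : MeasurableSet U :=
    Finset.measurableSet_biUnion _ fun j _ => measurable_shift _ hRm
  have hPU : iidMeasure μ p₀ U ≤ 1 / 2 := by
    refine (measure_biUnion_finset_le _ _).trans (le_trans (le_of_eq ?_) hα)
    rw [Finset.sum_congr rfl (g := fun _ => iidMeasure μ p₀ R) fun j _ => by
      rw [← Measure.map_apply (measurable_shift _) hRm, iidMeasure_map_shift h₀]]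
    simp
  have hPUc : 1 / 2 ≤ iidMeasure μ p₀ Uᶜ := by
    have h := prob_add_prob_compl (μ := iidMeasure μ p₀) hU
    have h2 : (1 / 2 : ℝ≥0∞) + 1 / 2 ≤ 1 / 2 + iidMeasure μ p₀ Uᶜ := by
      rw [ENNReal.add_halves]
      refine h.symm.le.trans ?_
      gcongr
    exact (ENNReal.add_le_add_iff_left (by finiteness)).1 h2
  calc ((J * L : ℕ) : ℝ≥0∞) * (1 / 2) ≤ ((J * L : ℕ) : ℝ≥0∞) * iidMeasure μ p₀ Uᶜ := by gcongr
    _ = ∫⁻ _ in Uᶜ, ((J * L : ℕ) : ℝ≥0∞) ∂iidMeasure μ p₀ := (setLIntegral_const _ _).symm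
    _ ≤ ∫⁻ ω in Uᶜ, (blockTime L R ω : ℝ≥0∞) ∂iidMeasure μ p₀ := by
        refine setLIntegral_mono_ae' hU.compl (ae_of_all _ fun ω hω => ?_)
        rw [← ENat.toENNReal_coe, ENat.toENNReal_le]
        refine le_iInf₂ fun j hj => ?_
        have hJ : J ≤ j := by
          by_contra hlt
          exact hω (Set.mem_biUnion
            (Finset.mem_coe.2 (Finset.mem_range.2 (not_le.1 hlt))) hj)
        exact_mod_cast Nat.mul_le_mul_right L (by omega)
    _ ≤ _ := setLIntegral_le_lintegral _ _

theorem worstDelay_blockTime_le (h₀ : IsPDF μ p₀) (h₁ : IsPDF μ p₁) {L : ℕ} (hL : 0 < L)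
    {R : Set (ℕ → 𝓧)} (hR : MeasurableSet[history 𝓧 L] R) (hβ : iidMeasure μ p₁ Rᶜ ≤ 2⁻¹) :
    worstDelay μ p₀ p₁ (blockTime L R) ≤ 3 * L := by
  refine (worstDelay_le_iff h₀ h₁).2 fun n A hA => ?_
  -- The first block made up entirely of post-change observations: `j₀` = ⌈n / L⌉.
  obtain ⟨j₀, hj₁, hj₂⟩ : ∃ j₀, n ≤ j₀ * L ∧ j₀ * L ≤ n + L := by
    refine ⟨(n + L - 1) / L, ?_, ?_⟩
    · have := Nat.lt_div_mul_add (a := n + L - 1) hL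
      omega
    · have := Nat.div_mul_le_self (n + L - 1) L
      omega
  set P := changeMeasure μ p₀ p₁ (n + 1)
  set C : ℕ → Set (ℕ → 𝓧) := fun i => ⋂ j ∈ Finset.range i, shift ((j₀ + j) * L) ⁻¹' Rᶜ
  have hRc : MeasurableSet[history 𝓧 L] Rᶜ := hR.compl
  have hC : ∀ i, MeasurableSet[history 𝓧 ((j₀ + i) * L)] (C i) := fun i => by
    refine @Finset.measurableSet_biInter _ _ (history 𝓧 ((j₀ + i) * L)) _ _ fun j hj => ?_
    refine measurableSet_shift_preimage ?_ hRc
    rw [← Nat.succ_mul]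
    have := Finset.mem_range.1 hj
    exact Nat.mul_le_mul_right L (by omega)
  have hCm : ∀ i, MeasurableSet (C i) := fun i => (history 𝓧).le _ _ (hC i)
  have hn : ∀ i, n ≤ (j₀ + i) * L := fun i =>
    hj₁.trans (Nat.mul_le_mul_right L (Nat.le_add_right _ _))
  have hPC : ∀ i, P (A ∩ C i) ≤ P A * 2⁻¹ ^ i := by
    intro i
    induction i with
    | zero => simpa using measure_mono Set.inter_subset_left
    | succ i ih =>
      have e : A ∩ C (i + 1) = (A ∩ C i) ∩ shift ((j₀ + i) * L) ⁻¹' Rᶜ := by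
        simp only [C, Finset.range_add_one, Finset.set_biInter_insert]
        rw [Set.inter_assoc, Set.inter_comm (shift ((j₀ + i) * L) ⁻¹' Rᶜ)]
      have hACi : MeasurableSet[history 𝓧 ((j₀ + i) * L)] (A ∩ C i) :=
        MeasurableSet.inter ((history 𝓧).mono (hn i) _ hA) (hC i)
      rw [e, changeMeasure_inter_shift h₀ h₁ (hn i) hACi ((history 𝓧).le _ _ hRc),
        pow_succ, ← mul_assoc]
      gcongr
  calc ∫⁻ ω in A, ((blockTime L R ω - n : ℕ∞) : ℝ≥0∞) ∂P
      ≤ ∫⁻ ω in A, (L + ∑' i, (C i).indicator (fun _ => (L : ℝ≥0∞)) ω) ∂P :=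
        lintegral_mono fun ω => toENNReal_blockTime_sub_le hL hj₂ ω
    _ = L * P A + ∑' i, L * P (A ∩ C i) := by
        rw [lintegral_add_left measurable_const, setLIntegral_const, lintegral_tsum fun i =>
          (measurable_const.indicator (hCm i)).aemeasurable]
        congr 2
        ext1 i
        rw [lintegral_indicator_const (hCm i), Measure.restrict_apply (hCm i), Set.inter_comm]
    _ ≤ L * P A + ∑' i, L * (P A * 2⁻¹ ^ i) := by
        gcongr with i
        exact hPC i
    _ = 3 * L * P A := by
        rw [ENNReal.tsum_mul_left, ENNReal.tsum_mul_left, ENNReal.tsum_geometric,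
          ENNReal.one_sub_inv_two, inv_inv]
        ring

theorem optimalDelay_le_of_test (h₀ : IsPDF μ p₀) (h₁ : IsPDF μ p₁) {L J : ℕ} (hL : 0 < L)
    {R : Set (ℕ → 𝓧)} (hR : MeasurableSet[history 𝓧 L] R)
    (hα : J * iidMeasure μ p₀ R ≤ 1 / 2) (hβ : iidMeasure μ p₁ Rᶜ ≤ 2⁻¹) {γ : ℝ}
    (hγ : γ ≤ J * L / 2) : optimalDelay μ p₀ p₁ γ ≤ 3 * L := by
  refine iInf_le_of_le (blockTime L R) (iInf₂_le_of_le (isStoppingTime_blockTime hR) ?_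
    (worstDelay_blockTime_le h₀ h₁ hL hR hβ))
  refine le_trans ?_ (le_lintegral_blockTime h₀ hR hα)
  refine (ENNReal.ofReal_le_ofReal hγ).trans_eq ?_
  rw [ENNReal.ofReal_div_of_pos (by norm_num), ENNReal.ofReal_mul (by positivity)]
  simp [div_eq_mul_inv]

theorem optimalDelay_le_of_sprt (h₀ : IsPDF μ p₀) (h₁ : IsPDF μ p₁)
    (hpos₀ : ∀ᵐ x ∂law μ p₀, 0 < p₀ x ∧ 0 < p₁ x)
    (hpos₁ : ∀ᵐ x ∂law μ p₁, 0 < p₀ x ∧ 0 < p₁ x) (hne : ¬ p₁ =ᵐ[μ] p₀)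
    (hD : D μ p₀ p₁ ≠ ∞) {L J : ℕ} (hL : 0 < L) (hJ : 0 < J)
    (hover : |∫ ω, (sprtValue p₀ p₁ (-1) (Real.log (4 * J)) ω - (-1))
      ∂(ProbabilityTheory.cond (iidMeasure μ p₀)
        {ω | sprtValue p₀ p₁ (-1) (Real.log (4 * J)) ω ≤ -1})| ≤ 1)
    (hLD : 8 * J ≤ L * (D μ p₀ p₁).toReal) {γ : ℝ} (hγ : γ ≤ J * L / 2) :
    optimalDelay μ p₀ p₁ γ ≤ 3 * L := by
  have := isProbabilityMeasure_iidMeasure h₀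
  set b := Real.log (4 * J)
  have hJr : (0 : ℝ) < J := by exact_mod_cast hJ
  have hacc := measurableSet_acceptSet h₀ h₁ (-1) b L
  refine optimalDelay_le_of_test h₀ h₁ (R := (acceptSet p₀ p₁ (-1) b L)ᶜ) hL hacc.compl ?_ ?_ hγ
  · have hW := mul_toReal_D_le h₀ h₁ hpos₀ hpos₁ hne hD (by norm_num) hover L
    set s := {ω | (L : ℕ∞) < sprtTime p₀ p₁ (-1) b ω}
    have hs0 : 0 ≤ (iidMeasure μ p₀).real s := measureReal_nonneg
    -- With a = -1, Wald gives L · P(s) · D ≤ 2, while LD ≥ 8J.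
    have hs : (iidMeasure μ p₀).real s ≤ 1 / (4 * J) := by
      rw [le_div_iff₀ (by positivity)]
      nlinarith
    have hexp : Real.exp (-b) = 1 / (4 * J) := by
      rw [Real.exp_neg, Real.exp_log (by positivity), one_div]
    have hc := iidMeasure_compl_acceptSet_le h₀ h₁ hpos₀ hpos₁ (-1) b L
    have hc2 : iidMeasure μ p₀ (acceptSet p₀ p₁ (-1) b L)ᶜ ≤ ENNReal.ofReal (1 / (2 * J)) := by
      refine hc.trans ?_
      rw [hexp, ← ofReal_measureReal, ← ENNReal.ofReal_add hs0 (by positivity)]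
      refine ENNReal.ofReal_le_ofReal ?_
      have : (1 : ℝ) / (2 * J) = 1 / (4 * J) + 1 / (4 * J) := by field_simp; norm_num
      linarith
    calc (J : ℝ≥0∞) * iidMeasure μ p₀ (acceptSet p₀ p₁ (-1) b L)ᶜ
        ≤ J * ENNReal.ofReal (1 / (2 * J)) := by gcongr
      _ = ENNReal.ofReal (1 / 2) := by
          rw [← ENNReal.ofReal_natCast, ← ENNReal.ofReal_mul hJr.le]
          congr 1
          field_simp
      _ = 1 / 2 := by rw [ENNReal.ofReal_div_of_pos (by norm_num)]; simp
  · rw [compl_compl]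
    refine (iidMeasure_acceptSet_le h₀ h₁ hpos₀ hpos₁ (-1) b L).trans ?_
    have h2 : Real.exp (-1) ≤ 2⁻¹ := by
      rw [Real.exp_neg]
      refine inv_anti₀ (by norm_num) ?_
      have := Real.add_one_le_exp (1 : ℝ)
      linarith
    refine (ENNReal.ofReal_le_ofReal h2).trans_eq ?_
    rw [ENNReal.ofReal_inv_of_pos (by norm_num)]
    simp

end Blocks

end CovertQCD

/-! ### The asymptotic statements. -/

theorem mainTheorem11 {𝓧 : Type*} [MeasurableSpace 𝓧] (μ : Measure 𝓧) [SigmaFinite μ]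
    (q : 𝓧 → ℝ) (qγ : ℝ → 𝓧 → ℝ)
    (hq : CovertQCD.IsPDF μ q)
    (hqγ : ∀ γ : ℝ, 0 < γ → CovertQCD.IsPDF μ (qγ γ))
    -- the two densities differ on a set of positive measure
    (hne : ∀ γ : ℝ, 0 < γ → ¬ (qγ γ =ᵐ[μ] q))
    -- the log-likelihood ratio is finite almost surely under both densities
    (hllr : ∀ γ : ℝ, 0 < γ →
      (∀ᵐ x ∂(CovertQCD.law μ q), 0 < q x ∧ 0 < qγ γ x) ∧
      (∀ᵐ x ∂(CovertQCD.law μ (qγ γ)), 0 < q x ∧ 0 < qγ γ x))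
    -- both Kullback-Leibler divergences are finite
    (hD : ∀ γ : ℝ, 0 < γ → CovertQCD.D μ q (qγ γ) ≠ ∞ ∧ CovertQCD.D μ (qγ γ) q ≠ ∞)
    -- the expected overshoots vanish under both densities
    (hover : CovertQCD.OvershootsVanish μ q qγ (fun _ => q) ∧
      CovertQCD.OvershootsVanish μ q qγ qγ) :
    -- `n(γ)` is finite and its order never exceeds that of `γ`
    (∀ γ : ℝ, 0 < γ → CovertQCD.optimalDelay μ q (qγ γ) γ ≠ ∞) ∧
    (fun γ : ℝ => (CovertQCD.optimalDelay μ q (qγ γ) γ).toReal) =O[atTop] (fun γ : ℝ => γ) ∧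
    -- this order is attained when `γ D(q‖q_γ)` converges to a finite constant
    (∀ y : ℝ, Tendsto (fun γ : ℝ => γ * (CovertQCD.D μ q (qγ γ)).toReal) atTop (𝓝 y) →
      (fun γ : ℝ => (CovertQCD.optimalDelay μ q (qγ γ) γ).toReal) =Θ[atTop]
        (fun γ : ℝ => γ)) ∧
    -- and it is not attained when `γ D(q‖q_γ)` tends to infinity
    (Tendsto (fun γ : ℝ => γ * (CovertQCD.D μ q (qγ γ)).toReal) atTop atTop →
      (fun γ : ℝ => (CovertQCD.optimalDelay μ q (qγ γ) γ).toReal) =o[atTop]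
        (fun γ : ℝ => γ)) := by
  have hO : (fun γ : ℝ => (CovertQCD.optimalDelay μ q (qγ γ) γ).toReal) =O[atTop]
      (fun γ : ℝ => γ) := by
    refine IsBigO.of_bound 2 ?_
    filter_upwards [eventually_ge_atTop 1] with γ hγ
    have h0 : 0 < γ := by linarith
    have h := ENNReal.toReal_mono (ENNReal.natCast_ne_top _)
      (CovertQCD.optimalDelay_le_natCast hq (hqγ γ h0) (Nat.le_ceil γ))
    rw [ENNReal.toReal_natCast] at h
    rw [Real.norm_of_nonneg ENNReal.toReal_nonneg, Real.norm_of_nonneg h0.le]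
    linarith [Nat.ceil_lt_add_one h0.le]
  have hfin : ∀ γ : ℝ, 0 < γ → CovertQCD.optimalDelay μ q (qγ γ) γ ≠ ∞ := fun γ hγ =>
    ne_top_of_le_ne_top (ENNReal.natCast_ne_top _)
      (CovertQCD.optimalDelay_le_natCast hq (hqγ γ hγ) (Nat.le_ceil γ))
  refine ⟨hfin, hO, fun y hy => ⟨hO, ?_⟩, fun hy => isLittleO_iff.2 fun ε hε => ?_⟩
  -- With m = ⌊cγ⌋, the bound 1/8 ensures 4m < γ and the bound 1/(|y| + 1) ensures mD ≤ 1 once γD <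
  -- |y| + 1.
  · set c : ℝ := min (1 / 8) (1 / (|y| + 1))
    have hy0 : 0 < |y| + 1 := by positivity
    have hc : 0 < c := lt_min (by norm_num) (by positivity)
    have hcy : c * (|y| + 1) ≤ 1 := by
      rw [← le_div_iff₀ hy0]
      exact min_le_right _ _
    have hc8 : c ≤ 1 / 8 := min_le_left _ _
    have he : 0 < Real.exp (-4) := Real.exp_pos _
    refine IsBigO.of_bound (8 / (c * Real.exp (-4))) ?_
    -- For cγ ≥ 2 the floor loses at most half, m ≥ cγ/2, which accounts for the 8 in the constant.
    filter_upwards [eventually_ge_atTop (2 / c),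
      hy.eventually (gt_mem_nhds (by linarith [le_abs_self y] : y < |y| + 1))] with γ hγ hyγ
    rw [div_le_iff₀' hc] at hγ
    have h0 : 0 < γ := by
      by_contra! h
      nlinarith
    obtain ⟨m, hm⟩ : ∃ m, m = ⌊c * γ⌋₊ := ⟨_, rfl⟩
    have hm1 : (m : ℝ) ≤ c * γ := hm ▸ Nat.floor_le (by positivity)
    have hm2 : c * γ < m + 1 := hm ▸ Nat.lt_floor_add_one _
    have hm3 : (0 : ℝ) < m := by linarith
    have hd0 : 0 ≤ (CovertQCD.D μ q (qγ γ)).toReal := ENNReal.toReal_nonneg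
    have hmD : m * (CovertQCD.D μ q (qγ γ)).toReal ≤ 1 := by
      calc m * (CovertQCD.D μ q (qγ γ)).toReal ≤ c * γ * (CovertQCD.D μ q (qγ γ)).toReal := by
            gcongr
        _ = c * (γ * (CovertQCD.D μ q (qγ γ)).toReal) := by ring
        _ ≤ c * (|y| + 1) := by gcongr
        _ ≤ 1 := hcy
    have h := ENNReal.toReal_mono (hfin γ h0) (CovertQCD.le_optimalDelay hq (hqγ γ h0)
      (hllr γ h0).1 (hllr γ h0).2 (hD γ h0).1 (by exact_mod_cast hm3) hmD
      (by nlinarith : 4 * (m : ℝ) < γ))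
    rw [ENNReal.toReal_div, ENNReal.toReal_mul, ENNReal.toReal_natCast,
      ENNReal.toReal_ofReal he.le, ENNReal.toReal_ofNat] at h
    rw [Real.norm_of_nonneg ENNReal.toReal_nonneg, Real.norm_of_nonneg h0.le, div_mul_eq_mul_div,
      le_div_iff₀ (by positivity)]
    nlinarith
  · set δ : ℝ := ε / 6
    have hδ : 0 < δ := by positivity
    -- J depends on δ but not on γ, so the thresholds are fixed and the overshoot assumption
    -- applies. The choice gives JL/2 ≥ Jδγ/2 ≥ γ.
    obtain ⟨J, hJ⟩ : ∃ J : ℕ, 2 / δ < J := exists_nat_gt _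
    have hJ0 : (0 : ℝ) < J := lt_trans (by positivity) hJ
    have hJ1 : (1 : ℝ) ≤ J := by exact_mod_cast (by exact_mod_cast hJ0 : 0 < J)
    have hov := (hover.1 (-1) (Real.log (4 * J)) (by norm_num)
      (Real.log_pos (by linarith))).2.eventually (Metric.ball_mem_nhds 0 one_pos)
    -- Since δγ ≥ 1, L = ⌈δγ⌉ ≤ 2δγ and so 3L ≤ 6δγ = εγ; the last condition yields LD ≥ δγD ≥ 8J.
    filter_upwards [eventually_ge_atTop (1 / δ), hov,
      hy.eventually (eventually_ge_atTop (8 * J / δ))] with γ hγ hovγ hyγ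
    rw [div_le_iff₀' hδ] at hγ hyγ
    rw [div_lt_iff₀' hδ] at hJ
    have h0 : 0 < γ := by
      by_contra! h
      nlinarith
    rw [Real.dist_eq, sub_zero] at hovγ
    have hd0 : 0 ≤ (CovertQCD.D μ q (qγ γ)).toReal := ENNReal.toReal_nonneg
    have hL1 : δ * γ ≤ ⌈δ * γ⌉₊ := Nat.le_ceil _
    have hL2 : (⌈δ * γ⌉₊ : ℝ) < δ * γ + 1 := Nat.ceil_lt_add_one (by positivity)
    have h := CovertQCD.optimalDelay_le_of_sprt hq (hqγ γ h0) (hllr γ h0).1 (hllr γ h0).2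
      (hne γ h0) (hD γ h0).1 (L := ⌈δ * γ⌉₊) (J := J) (γ := γ) (Nat.ceil_pos.2 (by positivity))
      (by exact_mod_cast hJ0) hovγ.le (by nlinarith) (by nlinarith)
    have h' := ENNReal.toReal_mono (by finiteness) h
    rw [ENNReal.toReal_mul, ENNReal.toReal_natCast, ENNReal.toReal_ofNat] at h'
    rw [Real.norm_of_nonneg ENNReal.toReal_nonneg, Real.norm_of_nonneg h0.le]
    have : ε = 6 * δ := by simp only [δ]; ring
    rw [this]
    linarith
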